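/- Conventions. A category is regular if it has finite limits, every kernel pair has a coequalizer, and regular epimorphisms are stable under pullback; it is exact if moreover every internal equivalence relation is effective, that is, is a kernel pair and has a coequalizer of which it is the kernel pair. A functor between such categories is regular if it preserves finite limits and regular epimorphisms. For a regular category $\mathcal X$, a relation from $X$ to $Y$ is a subobject of $X\times Y$; relations are ordered by inclusion, composed by pullback and image (written $R;S$ in diagrammatic order), and $R^\circ$ denotes the opposite relation. The exact completion $\mathcal X_{\mathrm{ex/reg}}$ has as objects the pairs $(X,R)$ with $R$ an equivalence relation on $X$ in $\mathcal X$, and as morphisms $(X,R)\to(Y,S)$ the relations $M$ from $X$ to $Y$ with $R;M=M=M;S$, $R\le M;M^\circ$ and $M^\circ;M\le S$, i.e. the maps in the bicategory obtained from the relations of $\mathcal X$ by freely splitting equivalence relations; composition is composition of relations and the identity of $(X,R)$ is $R$. The functor $I\colon\mathcal X\to\mathcal X_{\mathrm{ex/reg}}$ sends $X$ to $(X,1_X)$ and a morphism to its graph. Proposition. Let $\mathcal X$ be a regular category, $\mathcal D$ an exact category, and $F\colon\mathcal X\to\mathcal D$ a regular functor. There is a regular functor $G\colon\mathcal X_{\mathrm{ex/reg}}\to\mathcal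 D$ with $GI\cong F$, and any such (induced) functor $G$ is an equivalence of categories if and only if the following three conditions hold: 1. $F$ is fully faithful; 2. the image of $F$ is closed under subobjects: if $m\colon D\to FY$ is a monomorphism in $\mathcal D$, then $D\cong FX$ for some object $X$ of $\mathcal X$; 3. for every object $D$ of $\mathcal D$ there are an object $X$ of $\mathcal X$ and a regular epimorphism $q\colon FX\to D$. -/

import Mathlib

open CategoryTheory CategoryTheory.Limits

universe u v u₁ v₁ u₂ v₂

/-- A (Barr-)exact category: a regular category in which every internal equivalence relation is
effective, i.e. is the kernel pair of its coequalizer. -/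
class BarrExact (C : Type u) [Category.{v} C] : Prop extends Regular C where
  effective : ∀ {R A : C} (p₁ p₂ : R ⟶ A), IsEquivalenceRelation p₁ p₂ →
    IsEffectiveEquivalenceRelation p₁ p₂

/-- A regular functor: it preserves finite limits and regular epimorphisms. -/
structure IsRegularFunctor {C : Type u₁} [Category.{v₁} C] {D : Type u₂} [Category.{v₂} D]
    (F : C ⥤ D) : Prop where
  preservesFiniteLimits : PreservesFiniteLimits F
  map_isRegularEpi : ∀ {X Y : C} (f : X ⟶ Y), IsRegularEpi f → IsRegularEpi (F.map f)

namespace InternalRel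

section FiniteLimits

variable {C : Type u} [Category.{v} C] [HasFiniteLimits C]

/-- A relation from `X` to `Y` is a subobject of `X ⨯ Y`; relations are ordered as subobjects. -/
abbrev Relation (X Y : C) : Type (max u v) := Subobject (X ⨯ Y)

/-- The generalised elements `x : T ⟶ X` and `y : T ⟶ Y` are related by `R`. -/
def Mem {X Y T : C} (R : Relation X Y) (x : T ⟶ X) (y : T ⟶ Y) : Prop :=
  R.Factors (prod.lift x y)

/-- The opposite relation, along the symmetry `Y ⨯ X ⟶ X ⨯ Y`. -/
noncomputable def opp {X Y : C} (R : Relation X Y) : Relation Y X :=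
  (Subobject.pullback (prod.lift prod.snd prod.fst : Y ⨯ X ⟶ X ⨯ Y)).obj R

/-- The graph of a morphism, as a relation. -/
noncomputable def graph {X Y : C} (f : X ⟶ Y) : Relation X Y :=
  Subobject.mk (prod.lift (𝟙 X) f)

lemma hom_ext_prod {X Y T : C} {f g : T ⟶ X ⨯ Y} (h₁ : f ≫ prod.fst = g ≫ prod.fst)
    (h₂ : f ≫ prod.snd = g ≫ prod.snd) : f = g :=
  Limits.prod.hom_ext h₁ h₂

lemma Mem.precomp {X Y T T' : C} {R : Relation X Y} {x : T ⟶ X} {y : T ⟶ Y}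
    (h : Mem R x y) (e : T' ⟶ T) : Mem R (e ≫ x) (e ≫ y) := by
  unfold Mem at *
  rw [← prod.comp_lift]
  exact Subobject.factors_of_factors_right e h

lemma Mem.mono {X Y T : C} {R S : Relation X Y} {x : T ⟶ X} {y : T ⟶ Y}
    (h : Mem R x y) (le : R ≤ S) : Mem S x y :=
  Subobject.factors_of_le _ le h

lemma le_of_mem {X Y : C} {R S : Relation X Y}
    (h : ∀ {T : C} (x : T ⟶ X) (y : T ⟶ Y), Mem R x y → Mem S x y) : R ≤ S := by
  apply Subobject.le_of_factors
  have e : R.arrow = prod.lift (R.arrow ≫ prod.fst) (R.arrow ≫ prod.snd) := by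
    apply hom_ext_prod <;> simp [prod.lift_fst, prod.lift_snd]
  rw [e]
  apply h
  unfold Mem
  rw [← e]
  exact Subobject.factors_self R

lemma mem_opp {X Y T : C} {R : Relation X Y} {x : T ⟶ X} {y : T ⟶ Y} :
    Mem (opp R) y x ↔ Mem R x y := by
  have e : (prod.lift y x) ≫ (prod.lift prod.snd prod.fst : Y ⨯ X ⟶ X ⨯ Y) = prod.lift x y := by
    apply hom_ext_prod <;> simp [prod.lift_fst, prod.lift_snd]
  have sq := Subobject.isPullback (prod.lift prod.snd prod.fst : Y ⨯ X ⟶ X ⨯ Y) R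
  unfold Mem opp
  constructor
  · intro h
    rw [← e, ← Subobject.factorThru_arrow _ _ h, Category.assoc, ← sq.w, ← Category.assoc]
    exact Subobject.factors_comp_arrow _
  · intro h
    have hw : R.factorThru _ h ≫ R.arrow =
        (prod.lift y x) ≫ (prod.lift prod.snd prod.fst : Y ⨯ X ⟶ X ⨯ Y) := by
      rw [e]; simp
    rw [← sq.lift_snd _ _ hw]
    exact Subobject.factors_comp_arrow _

lemma mem_graph {X Y T : C} {f : X ⟶ Y} {x : T ⟶ X} {y : T ⟶ Y} :
    Mem (graph f) x y ↔ x ≫ f = y := by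
  unfold Mem graph
  constructor
  · intro h
    have h' := Subobject.factorThru_arrow _ _ h
    rw [← Subobject.underlyingIso_hom_comp_eq_mk] at h'
    have h₁ := h' =≫ prod.fst
    have h₂ := h' =≫ prod.snd
    simp only [Category.assoc, prod.lift_fst, prod.lift_snd, Category.comp_id] at h₁ h₂
    exact (congrArg (· ≫ f) h₁.symm).trans ((Category.assoc _ _ _).trans h₂)
  · rintro rfl
    have : prod.lift x (x ≫ f) = x ≫ prod.lift (𝟙 X) f := by
      apply hom_ext_prod <;> simp [prod.lift_fst, prod.lift_snd]
    rw [this]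
    exact Subobject.factors_of_factors_right x (Subobject.mk_factors_self _)

end FiniteLimits

variable {C : Type u} [Category.{v} C] [Regular C]

/-- The composite of relations, in diagrammatic order: the image in `X ⨯ Z` of the pullback
`R ×_Y S`. -/
noncomputable def comp {X Y Z : C} (R : Relation X Y) (S : Relation Y Z) : Relation X Z :=
  Subobject.mk (image.ι (prod.lift
    (pullback.fst (R.arrow ≫ prod.snd) (S.arrow ≫ prod.fst) ≫ R.arrow ≫ prod.fst)
    (pullback.snd (R.arrow ≫ prod.snd) (S.arrow ≫ prod.fst) ≫ S.arrow ≫ prod.snd)))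

lemma isRegularEpi_of_strongEpi {X Y : C} (f : X ⟶ Y) [StrongEpi f] : IsRegularEpi f := by
  infer_instance

lemma isRegularEpi_comp {X Y Z : C} (f : X ⟶ Y) (g : Y ⟶ Z) [IsRegularEpi f] [IsRegularEpi g] :
    IsRegularEpi (f ≫ g) := by
  have : StrongEpi (f ≫ g) := strongEpi_comp f g
  infer_instance

lemma Mem.of_cover {X Y T T' : C} {R : Relation X Y} {x : T ⟶ X} {y : T ⟶ Y}
    (e : T' ⟶ T) [IsRegularEpi e] (h : Mem R (e ≫ x) (e ≫ y)) : Mem R x y := by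
  unfold Mem at *
  rw [← prod.comp_lift] at h
  have sq : CommSq (R.factorThru _ h) e R.arrow (prod.lift x y) := ⟨by simp⟩
  rw [← sq.fac_right]
  exact Subobject.factors_comp_arrow _

lemma mem_comp {X Y Z T : C} {R : Relation X Y} {S : Relation Y Z} {x : T ⟶ X} {z : T ⟶ Z} :
    Mem (comp R S) x z ↔ ∃ (T' : C) (e : T' ⟶ T) (_ : IsRegularEpi e) (y : T' ⟶ Y),
      Mem R (e ≫ x) y ∧ Mem S y (e ≫ z) := by
  constructor
  · intro h
    set p := pullback.fst (R.arrow ≫ prod.snd) (S.arrow ≫ prod.fst) with hp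
    set q := pullback.snd (R.arrow ≫ prod.snd) (S.arrow ≫ prod.fst) with hq
    set g := prod.lift (p ≫ R.arrow ≫ prod.fst) (q ≫ S.arrow ≫ prod.snd) with hg
    have hpq : p ≫ R.arrow ≫ prod.snd = q ≫ S.arrow ≫ prod.fst := pullback.condition
    unfold Mem comp at h
    have h' := Subobject.factorThru_arrow _ _ h
    rw [← Subobject.underlyingIso_hom_comp_eq_mk, ← Category.assoc] at h'
    set t := (Subobject.mk (image.ι g)).factorThru _ h ≫ (Subobject.underlyingIso (image.ι g)).hom
      with ht
    have hr : IsRegularEpi (factorThruImage g) := isRegularEpi_of_strongEpi _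
    let e := pullback.fst t (factorThruImage g)
    let k := pullback.snd t (factorThruImage g)
    have hk : e ≫ prod.lift x z = k ≫ g := by
      refine (congrArg (e ≫ ·) h'.symm).trans ?_
      change e ≫ t ≫ image.ι g = k ≫ g
      rw [← Category.assoc, pullback.condition, Category.assoc, image.fac]
    have h₁ := hk =≫ prod.fst
    have h₂ := hk =≫ prod.snd
    simp only [Category.assoc, prod.lift_fst, prod.lift_snd, hg] at h₁ h₂
    refine ⟨_, e, inferInstance, k ≫ p ≫ R.arrow ≫ prod.snd, ?_, ?_⟩
    · rw [h₁]
      have : prod.lift (k ≫ p ≫ R.arrow ≫ prod.fst) (k ≫ p ≫ R.arrow ≫ prod.snd) =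
          (k ≫ p) ≫ R.arrow := by
        apply hom_ext_prod <;> simp [prod.lift_fst, prod.lift_snd]
      unfold Mem
      rw [this]
      exact Subobject.factors_comp_arrow _
    · rw [h₂, hpq]
      have : prod.lift (k ≫ q ≫ S.arrow ≫ prod.fst) (k ≫ q ≫ S.arrow ≫ prod.snd) =
          (k ≫ q) ≫ S.arrow := by
        apply hom_ext_prod <;> simp [prod.lift_fst, prod.lift_snd]
      unfold Mem
      rw [this]
      exact Subobject.factors_comp_arrow _
  · rintro ⟨T', e, _, y, hR, hS⟩
    apply Mem.of_cover e
    have e₁ := Subobject.factorThru_arrow _ _ hR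
    have e₂ := Subobject.factorThru_arrow _ _ hS
    have hw : R.factorThru _ hR ≫ R.arrow ≫ prod.snd = S.factorThru _ hS ≫ S.arrow ≫ prod.fst := by
      rw [← Category.assoc, ← Category.assoc, e₁, e₂, prod.lift_fst, prod.lift_snd]
    have key : prod.lift (e ≫ x) (e ≫ z) = (pullback.lift _ _ hw ≫ factorThruImage _) ≫
        image.ι (prod.lift
          (pullback.fst (R.arrow ≫ prod.snd) (S.arrow ≫ prod.fst) ≫ R.arrow ≫ prod.fst)
          (pullback.snd (R.arrow ≫ prod.snd) (S.arrow ≫ prod.fst) ≫ S.arrow ≫ prod.snd)) := by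
      rw [Category.assoc, image.fac]
      apply hom_ext_prod
      · have := e₁ =≫ prod.fst
        simp only [Category.assoc, prod.lift_fst] at this
        rw [prod.lift_fst, Category.assoc, prod.lift_fst, pullback.lift_fst_assoc, this]
      · have := e₂ =≫ prod.snd
        simp only [Category.assoc, prod.lift_snd] at this
        rw [prod.lift_snd, Category.assoc, prod.lift_snd, pullback.lift_snd_assoc, this]
    unfold Mem comp
    rw [key]
    exact Subobject.factors_of_factors_right _ (Subobject.mk_factors_self _)

lemma comp_mono {X Y Z : C} {R R' : Relation X Y} {S S' : Relation Y Z} (h : R ≤ R')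
    (h' : S ≤ S') : comp R S ≤ comp R' S' := by
  apply le_of_mem
  intro T x z hm
  obtain ⟨T', e, he, y, h₁, h₂⟩ := mem_comp.1 hm
  exact mem_comp.2 ⟨T', e, he, y, h₁.mono h, h₂.mono h'⟩

lemma comp_assoc {W X Y Z : C} (R : Relation W X) (S : Relation X Y) (Q : Relation Y Z) :
    comp (comp R S) Q = comp R (comp S Q) := by
  apply le_antisymm <;> apply le_of_mem <;> intro T w z hm
  · obtain ⟨T', e, he, y, h₁, h₂⟩ := mem_comp.1 hm
    obtain ⟨T'', e', he', x, h₃, h₄⟩ := mem_comp.1 h₁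
    refine mem_comp.2 ⟨T'', e' ≫ e, isRegularEpi_comp _ _, x, by simpa using h₃,
      mem_comp.2 ⟨T'', 𝟙 _, inferInstance, e' ≫ y, by simpa using h₄, ?_⟩⟩
    simpa using h₂.precomp e'
  · obtain ⟨T', e, he, x, h₁, h₂⟩ := mem_comp.1 hm
    obtain ⟨T'', e', he', y, h₃, h₄⟩ := mem_comp.1 h₂
    refine mem_comp.2 ⟨T'', e' ≫ e, isRegularEpi_comp _ _, y,
      mem_comp.2 ⟨T'', 𝟙 _, inferInstance, e' ≫ x, ?_, by simpa using h₃⟩, by simpa using h₄⟩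
    simpa using h₁.precomp e'

lemma opp_comp {X Y Z : C} (R : Relation X Y) (S : Relation Y Z) :
    opp (comp R S) = comp (opp S) (opp R) := by
  apply le_antisymm <;> apply le_of_mem <;> intro T z x hm
  · obtain ⟨T', e, he, y, h₁, h₂⟩ := mem_comp.1 (mem_opp.1 hm)
    exact mem_comp.2 ⟨T', e, he, y, mem_opp.2 h₂, mem_opp.2 h₁⟩
  · obtain ⟨T', e, he, y, h₁, h₂⟩ := mem_comp.1 hm
    exact mem_opp.2 (mem_comp.2 ⟨T', e, he, y, mem_opp.1 h₂, mem_opp.1 h₁⟩)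

lemma graph_id_comp {X Y : C} (R : Relation X Y) : comp (graph (𝟙 X)) R = R := by
  apply le_antisymm <;> apply le_of_mem <;> intro T x y hm
  · obtain ⟨T', e, he, x', h₁, h₂⟩ := mem_comp.1 hm
    rw [mem_graph, Category.comp_id] at h₁
    subst h₁
    exact h₂.of_cover e
  · exact mem_comp.2 ⟨T, 𝟙 _, inferInstance, x, mem_graph.2 (by simp), by simpa using hm⟩

lemma comp_graph_id {X Y : C} (R : Relation X Y) : comp R (graph (𝟙 Y)) = R := by
  apply le_antisymm <;> apply le_of_mem <;> intro T x y hm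
  · obtain ⟨T', e, he, y', h₁, h₂⟩ := mem_comp.1 hm
    rw [mem_graph, Category.comp_id] at h₂
    subst h₂
    exact h₁.of_cover e
  · exact mem_comp.2 ⟨T, 𝟙 _, inferInstance, y, by simpa using hm, mem_graph.2 (by simp)⟩

lemma graph_comp_graph {X Y Z : C} (f : X ⟶ Y) (g : Y ⟶ Z) :
    comp (graph f) (graph g) = graph (f ≫ g) := by
  apply le_antisymm <;> apply le_of_mem <;> intro T x z hm
  · obtain ⟨T', e, he, y, h₁, h₂⟩ := mem_comp.1 hm
    rw [mem_graph] at h₁ h₂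
    subst h₁
    refine Mem.of_cover e (mem_graph.2 ?_)
    simpa using h₂
  · rw [mem_graph] at hm
    exact mem_comp.2 ⟨T, 𝟙 _, inferInstance, x ≫ f, mem_graph.2 (by simp),
      mem_graph.2 (by simp [← hm])⟩

/-- Equivalence relations, in the calculus of relations: reflexive, symmetric, transitive. -/
structure IsEquiv {X : C} (R : Relation X X) : Prop where
  refl : graph (𝟙 X) ≤ R
  symm : R ≤ opp R
  trans : comp R R ≤ R

lemma IsEquiv.idem {X : C} {R : Relation X X} (h : IsEquiv R) : comp R R = R := by
  apply le_antisymm h.trans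
  calc R = comp (graph (𝟙 X)) R := (graph_id_comp R).symm
    _ ≤ comp R R := comp_mono h.refl le_rfl

end InternalRel

open InternalRel

/-- The objects of the exact completion of the regular category `C`: pairs `(X, R)` of an object
and an equivalence relation on it, i.e. the objects of the bicategory obtained from `Rel(C)` by
freely splitting the idempotents which are equivalence relations. -/
structure ExReg (C : Type u) [Category.{v} C] [Regular C] : Type (max u v) where
  carrier : C
  rel : Relation carrier carrier
  isEquiv : IsEquiv rel

namespace ExReg

variable {C : Type u} [Category.{v} C] [Regular C]

/-- The morphisms `(X, R) ⟶ (Y, S)` of the exact completion. The first two laws say that `rel` is a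
morphism `(X, R) ⟶ (Y, S)` of the splitting of the equivalence relations in `Rel(C)`; there the
identities of `(X, R)` and `(Y, S)` are `R` and `S`. The last two laws say that this morphism is a
map, its right adjoint being the opposite relation. -/
@[ext]
structure Hom (A B : ExReg C) : Type (max u v) where
  rel : Relation A.carrier B.carrier
  left_comp : comp A.rel rel = rel
  comp_right : comp rel B.rel = rel
  total : A.rel ≤ comp rel (opp rel)
  singleValued : comp (opp rel) rel ≤ B.rel

lemma opp_rel (A : ExReg C) : opp A.rel = A.rel := by
  apply le_antisymm _ A.isEquiv.symm
  apply le_of_mem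
  intro T x y h
  exact mem_opp.1 ((mem_opp.1 h).mono A.isEquiv.symm)

/-- The category of maps in the splitting of the equivalence relations in `Rel(C)`: the exact
completion of the regular category `C`. -/
noncomputable instance : Category.{max u v} (ExReg C) where
  Hom := Hom
  id A :=
    { rel := A.rel
      left_comp := A.isEquiv.idem
      comp_right := A.isEquiv.idem
      total := by rw [opp_rel, A.isEquiv.idem]
      singleValued := by rw [opp_rel, A.isEquiv.idem] }
  comp {A B D} f g :=
    { rel := InternalRel.comp f.rel g.rel
      left_comp := by rw [← comp_assoc, f.left_comp]
      comp_right := by rw [comp_assoc, g.comp_right]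
      total := by
        calc A.rel ≤ InternalRel.comp f.rel (opp f.rel) := f.total
          _ = InternalRel.comp (InternalRel.comp f.rel B.rel) (opp f.rel) := by rw [f.comp_right]
          _ ≤ InternalRel.comp (InternalRel.comp f.rel (InternalRel.comp g.rel (opp g.rel)))
                (opp f.rel) := comp_mono (comp_mono le_rfl g.total) le_rfl
          _ = _ := by simp only [opp_comp, comp_assoc]
      singleValued := by
        calc InternalRel.comp (opp (InternalRel.comp f.rel g.rel)) (InternalRel.comp f.rel g.rel)
            = InternalRel.comp (opp g.rel)
                (InternalRel.comp (InternalRel.comp (opp f.rel) f.rel) g.rel) := by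
              simp only [opp_comp, comp_assoc]
          _ ≤ InternalRel.comp (opp g.rel) (InternalRel.comp B.rel g.rel) :=
              comp_mono le_rfl (comp_mono f.singleValued le_rfl)
          _ = InternalRel.comp (opp g.rel) g.rel := by rw [g.left_comp]
          _ ≤ D.rel := g.singleValued }
  id_comp f := Hom.ext f.left_comp
  comp_id f := Hom.ext f.comp_right
  assoc f g h := Hom.ext (comp_assoc f.rel g.rel h.rel)

lemma isEquiv_graph_id (X : C) : IsEquiv (graph (𝟙 X)) where
  refl := le_rfl
  symm := by
    apply le_of_mem
    intro T x y h
    rw [mem_graph, Category.comp_id] at h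
    exact mem_opp.2 (mem_graph.2 (by simp [h]))
  trans := (graph_id_comp _).le

variable (C) in
/-- The unit functor `I : C ⥤ ExReg C`, sending `X` to `(X, 1_X)` and a morphism to its graph. -/
noncomputable def unit : C ⥤ ExReg C where
  obj X := ⟨X, graph (𝟙 X), isEquiv_graph_id X⟩
  map {X Y} f :=
    { rel := graph f
      left_comp := graph_id_comp _
      comp_right := comp_graph_id _
      total := by
        apply le_of_mem
        intro T x y h
        rw [mem_graph, Category.comp_id] at h
        subst h
        exact mem_comp.2 ⟨T, 𝟙 _, inferInstance, x ≫ f, mem_graph.2 (by simp),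
          mem_opp.2 (mem_graph.2 (by simp))⟩
      singleValued := by
        apply le_of_mem
        intro T y y' h
        obtain ⟨T', e, he, x, h₁, h₂⟩ := mem_comp.1 h
        rw [mem_opp, mem_graph] at h₁
        rw [mem_graph] at h₂
        refine Mem.of_cover e (mem_graph.2 ?_)
        rw [Category.comp_id, ← h₁, h₂] }
  map_id X := rfl
  map_comp f g := Hom.ext (graph_comp_graph f g).symm

end ExReg

/-! ### Relations in a regular category through generalised elements -/

namespace InternalRel

/-! Relations are handled through generalised elements, with existence meaning existence after
pulling back along a regular epimorphism (a cover). An object `(X, R)` of the exact completion is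
the quotient of `(X, 1_X)` by `R`, and the relation `M` of a morphism `A ⟶ B` is recovered from the
morphism as the pullback of `quotientMap A ≫ M` and `quotientMap B` (`isPullback_quotientMap`). A
regular `G` with `GI ≅ F` preserves both facts. So it sends `(X, R)` to the quotient of `FX` by
`FR`, and `FM` is the pullback of `q A ≫ G M` and `q B`. This is `IsPresentation`, and
`exists_isPresentation` provides it for every such `G`.

Existence of `G`: since `D` is exact, the equivalence relation `FR` is the kernel pair of a quotient
`q`. Morphisms descend to these quotients, and regularity of the resulting functor is checked on
representatives in `FX`.

Sufficiency of the three conditions: by the first two, the pullback of any `FX ⟶ d` and `FY ⟶ d` is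
a subobject of `F(X ⨯ Y)`, hence the image of a relation in the domain of `F` (`exists_mapMem_iff`).
Applied to `q A ≫ g` and `q B`, this gives a preimage of `g`. Applied twice to a cover `FX ⟶ d`, it
gives an equivalence relation whose quotient is `d`. Faithfulness holds because `F` reflects
inclusions of relations (`le_of_mapMem`).

Necessity: the unit is itself fully faithful, closed under subobjects and covering, and an
equivalence transports these properties. -/

/-- An element defined on a cover descends if it is compatible on the kernel pair. -/
lemma exists_desc {C : Type u} [Category.{v} C] {T T' X : C} (e : T' ⟶ T)
    [IsRegularEpi e] (y : T' ⟶ X)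
    (h : ∀ {U : C} (a b : U ⟶ T'), a ≫ e = b ≫ e → a ≫ y = b ≫ y) : ∃ z : T ⟶ X, e ≫ z = y :=
  ⟨IsRegularEpi.desc e y (h _ _ (IsRegularEpi.w e)), IsRegularEpi.fac _ _ _⟩

variable {C : Type u} [Category.{v} C]

section FiniteLimits

variable [HasFiniteLimits C]

lemma mem_iff {X Y T : C} {R : Relation X Y} {x : T ⟶ X} {y : T ⟶ Y} :
    Mem R x y ↔ ∃ t : T ⟶ (R : C), t ≫ R.arrow ≫ prod.fst = x ∧ t ≫ R.arrow ≫ prod.snd = y := by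
  constructor
  · intro h
    have h' := Subobject.factorThru_arrow _ _ h
    refine ⟨R.factorThru _ h, ?_, ?_⟩
    · rw [← Category.assoc, h', prod.lift_fst]
    · rw [← Category.assoc, h', prod.lift_snd]
  · rintro ⟨t, rfl, rfl⟩
    have : prod.lift (t ≫ R.arrow ≫ prod.fst) (t ≫ R.arrow ≫ prod.snd) = t ≫ R.arrow := by
      apply hom_ext_prod <;> simp [prod.lift_fst, prod.lift_snd]
    unfold Mem
    rw [this]
    exact Subobject.factors_comp_arrow _

lemma mem_arrow {X Y : C} (R : Relation X Y) : Mem R (R.arrow ≫ prod.fst) (R.arrow ≫ prod.snd) :=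
  mem_iff.2 ⟨𝟙 _, by simp, by simp⟩

/-- The two projections of `R` form its generic pair: every other related pair is a precomposite of
it. -/
lemma le_iff_mem_arrow {X Y : C} {R S : Relation X Y} :
    R ≤ S ↔ Mem S (R.arrow ≫ prod.fst) (R.arrow ≫ prod.snd) := by
  refine ⟨fun h => (mem_arrow R).mono h, fun h => le_of_mem fun x y hxy => ?_⟩
  obtain ⟨t, rfl, rfl⟩ := mem_iff.1 hxy
  exact h.precomp t

lemma mem_inf {X Y T : C} {R S : Relation X Y} {x : T ⟶ X} {y : T ⟶ Y} :
    Mem (R ⊓ S) x y ↔ Mem R x y ∧ Mem S x y :=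
  Subobject.inf_factors _

lemma mem_graph_id {X T : C} {x y : T ⟶ X} : Mem (graph (𝟙 X)) x y ↔ x = y := by
  rw [mem_graph, Category.comp_id]

end FiniteLimits

variable [Regular C]

lemma mem_comp_of_mem {X Y Z T : C} {R : Relation X Y} {S : Relation Y Z} {x : T ⟶ X}
    {y : T ⟶ Y} {z : T ⟶ Z} (h : Mem R x y) (h' : Mem S y z) : Mem (comp R S) x z :=
  mem_comp.2 ⟨T, 𝟙 T, inferInstance, y, by simpa using h, by simpa using h'⟩

/-- The relation `{(x, y) | R (f x) (g y)}`. -/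
noncomputable def inverseImage {X Y X' Y' : C} (f : X' ⟶ X) (g : Y' ⟶ Y) (R : Relation X Y) :
    Relation X' Y' :=
  comp (graph f) (comp R (opp (graph g)))

lemma mem_inverseImage {X Y X' Y' T : C} {f : X' ⟶ X} {g : Y' ⟶ Y} {R : Relation X Y}
    {x : T ⟶ X'} {y : T ⟶ Y'} : Mem (inverseImage f g R) x y ↔ Mem R (x ≫ f) (y ≫ g) := by
  constructor
  · intro h
    obtain ⟨T', e, he, x', h₁, h₂⟩ := mem_comp.1 h
    obtain ⟨T'', e', he', y', h₃, h₄⟩ := mem_comp.1 h₂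
    rw [mem_graph] at h₁
    rw [mem_opp, mem_graph] at h₄
    have := isRegularEpi_comp e' e
    apply Mem.of_cover (e' ≫ e)
    simpa [← h₁, ← h₄] using h₃
  · intro h
    exact mem_comp_of_mem (mem_graph.2 rfl) (mem_comp_of_mem h (mem_opp.2 (mem_graph.2 rfl)))

namespace IsEquiv

variable {X T : C} {R : Relation X X} (h : IsEquiv R)
include h

lemma mem_refl (x : T ⟶ X) : Mem R x x :=
  (mem_graph_id.2 rfl).mono h.refl

lemma mem_symm {x y : T ⟶ X} (hxy : Mem R x y) : Mem R y x :=
  mem_opp.1 (hxy.mono h.symm)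

lemma mem_trans {x y z : T ⟶ X} (hxy : Mem R x y) (hyz : Mem R y z) : Mem R x z :=
  (mem_comp_of_mem hxy hyz).mono h.trans

end IsEquiv

lemma isEquiv_of_mem {X : C} {R : Relation X X} (refl : ∀ {T : C} (x : T ⟶ X), Mem R x x)
    (symm : ∀ {T : C} (x y : T ⟶ X), Mem R x y → Mem R y x)
    (trans : ∀ {T : C} (x y z : T ⟶ X), Mem R x y → Mem R y z → Mem R x z) : IsEquiv R where
  refl := le_of_mem fun x y h => by
    obtain rfl := mem_graph_id.1 h
    exact refl x
  symm := le_of_mem fun x y h => mem_opp.2 (symm x y h)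
  trans := le_of_mem fun x z h => by
    obtain ⟨T', e, he, y, h₁, h₂⟩ := mem_comp.1 h
    exact Mem.of_cover e (trans _ _ _ h₁ h₂)

end InternalRel

/-! ### Morphisms of the exact completion through generalised elements -/

namespace ExReg

variable {C : Type u} [Category.{v} C] [Regular C]

namespace Hom

variable {A B : ExReg C} (f : A ⟶ B) {T : C}

lemma mem_left {x x' : T ⟶ A.carrier} {y : T ⟶ B.carrier} (h : Mem A.rel x x')
    (h' : Mem f.rel x' y) : Mem f.rel x y := by
  rw [← f.left_comp]
  exact mem_comp_of_mem h h'

lemma mem_right {x : T ⟶ A.carrier} {y y' : T ⟶ B.carrier} (h : Mem f.rel x y)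
    (h' : Mem B.rel y y') : Mem f.rel x y' := by
  rw [← f.comp_right]
  exact mem_comp_of_mem h h'

lemma mem_unique {x : T ⟶ A.carrier} {y y' : T ⟶ B.carrier} (h : Mem f.rel x y)
    (h' : Mem f.rel x y') : Mem B.rel y y' :=
  (mem_comp_of_mem (mem_opp.2 h) h').mono f.singleValued

lemma exists_mem (x : T ⟶ A.carrier) :
    ∃ (T' : C) (e : T' ⟶ T) (_ : IsRegularEpi e) (y : T' ⟶ B.carrier), Mem f.rel (e ≫ x) y := by
  obtain ⟨T', e, he, y, h, -⟩ := mem_comp.1 ((A.isEquiv.mem_refl x).mono f.total)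
  exact ⟨T', e, he, y, h⟩

/-- A morphism of the exact completion, from the laws for generalised elements. -/
def ofMem {A B : ExReg C} (M : Relation A.carrier B.carrier)
    (left : ∀ {T : C} {x x' : T ⟶ A.carrier} {y : T ⟶ B.carrier},
      Mem A.rel x x' → Mem M x' y → Mem M x y)
    (right : ∀ {T : C} {x : T ⟶ A.carrier} {y y' : T ⟶ B.carrier},
      Mem M x y → Mem B.rel y y' → Mem M x y')
    (unique : ∀ {T : C} {x : T ⟶ A.carrier} {y y' : T ⟶ B.carrier},
      Mem M x y → Mem M x y' → Mem B.rel y y')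
    (total : ∀ {T : C} (x : T ⟶ A.carrier), ∃ (T' : C) (e : T' ⟶ T) (_ : IsRegularEpi e)
      (y : T' ⟶ B.carrier), Mem M (e ≫ x) y) : A ⟶ B where
  rel := M
  left_comp := by
    apply le_antisymm <;> apply le_of_mem <;> intro T x y h
    · obtain ⟨T', e, he, x', h₁, h₂⟩ := mem_comp.1 h
      exact Mem.of_cover e (left h₁ h₂)
    · exact mem_comp_of_mem (A.isEquiv.mem_refl x) h
  comp_right := by
    apply le_antisymm <;> apply le_of_mem <;> intro T x y h
    · obtain ⟨T', e, he, x', h₁, h₂⟩ := mem_comp.1 h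
      exact Mem.of_cover e (right h₁ h₂)
    · exact mem_comp_of_mem h (B.isEquiv.mem_refl y)
  total := le_of_mem fun x x' h => by
    obtain ⟨T', e, he, y, h'⟩ := total x
    exact mem_comp.2 ⟨T', e, he, y, h', mem_opp.2 (left (A.isEquiv.mem_symm (h.precomp e)) h')⟩
  singleValued := le_of_mem fun y y' h => by
    obtain ⟨T', e, he, x, h₁, h₂⟩ := mem_comp.1 h
    exact Mem.of_cover e (unique (mem_opp.1 h₁) h₂)

end Hom

/-- One inclusion suffices: `f` has a local value at `x`, it is also a value of `g`, and values of
`g` are unique up to the relation of `B`, which `f` absorbs. -/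
lemma hom_ext_of_mem {A B : ExReg C} {f g : A ⟶ B}
    (h : ∀ {T : C} (x : T ⟶ A.carrier) (y : T ⟶ B.carrier), Mem f.rel x y → Mem g.rel x y) :
    f = g := by
  refine Hom.ext (le_antisymm (le_of_mem h) (le_of_mem fun x y hg => ?_))
  obtain ⟨T', e, he, y', hf⟩ := Hom.exists_mem f x
  exact Mem.of_cover e (Hom.mem_right f hf (Hom.mem_unique g (h _ _ hf) (hg.precomp e)))

lemma mem_id {A : ExReg C} {T : C} {x y : T ⟶ A.carrier} :
    Mem (Hom.rel (𝟙 A)) x y ↔ Mem A.rel x y :=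
  Iff.rfl

lemma mem_comp {A B D : ExReg C} {f : A ⟶ B} {g : B ⟶ D} {T : C} {x : T ⟶ A.carrier}
    {z : T ⟶ D.carrier} :
    Mem (f ≫ g).rel x z ↔ ∃ (T' : C) (e : T' ⟶ T) (_ : IsRegularEpi e) (y : T' ⟶ B.carrier),
      Mem f.rel (e ≫ x) y ∧ Mem g.rel y (e ≫ z) :=
  InternalRel.mem_comp

lemma mem_comp_of_mem {A B D : ExReg C} {f : A ⟶ B} {g : B ⟶ D} {T : C} {x : T ⟶ A.carrier}
    {y : T ⟶ B.carrier} {z : T ⟶ D.carrier} (h : Mem f.rel x y) (h' : Mem g.rel y z) :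
    Mem (f ≫ g).rel x z :=
  InternalRel.mem_comp_of_mem h h'

/-- The morphism of the exact completion represented by a morphism of underlying objects. -/
noncomputable def ofMap (A B : ExReg C) (f : A.carrier ⟶ B.carrier)
    (hf : ∀ {T : C} {x x' : T ⟶ A.carrier}, Mem A.rel x x' → Mem B.rel (x ≫ f) (x' ≫ f)) :
    A ⟶ B :=
  Hom.ofMem (inverseImage f (𝟙 _) B.rel)
    (fun h h' => by
      rw [mem_inverseImage] at *
      exact B.isEquiv.mem_trans (hf h) h')
    (fun h h' => by
      rw [mem_inverseImage, Category.comp_id] at *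
      exact B.isEquiv.mem_trans h h')
    (fun h h' => by
      rw [mem_inverseImage, Category.comp_id] at *
      exact B.isEquiv.mem_trans (B.isEquiv.mem_symm h) h')
    (fun x => ⟨_, 𝟙 _, inferInstance, x ≫ f, mem_inverseImage.2 (by
      simpa using B.isEquiv.mem_refl _)⟩)

section ofMap

variable {A B D : ExReg C} {f : A.carrier ⟶ B.carrier}
  {hf : ∀ {T : C} {x x' : T ⟶ A.carrier}, Mem A.rel x x' → Mem B.rel (x ≫ f) (x' ≫ f)} {T : C}

lemma mem_ofMap {x : T ⟶ A.carrier} {y : T ⟶ B.carrier} :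
    Mem (ofMap A B f hf).rel x y ↔ Mem B.rel (x ≫ f) y := by
  change Mem (inverseImage f (𝟙 _) B.rel) x y ↔ _
  rw [mem_inverseImage, Category.comp_id]

lemma mem_ofMap_comp {g : B ⟶ D} {x : T ⟶ A.carrier} {z : T ⟶ D.carrier} :
    Mem (ofMap A B f hf ≫ g).rel x z ↔ Mem g.rel (x ≫ f) z := by
  constructor
  · intro h
    obtain ⟨T', e, he, y, h₁, h₂⟩ := mem_comp.1 h
    rw [mem_ofMap, Category.assoc] at h₁
    exact Mem.of_cover e (Hom.mem_left g h₁ h₂)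
  · intro h
    exact mem_comp_of_mem (mem_ofMap.2 (B.isEquiv.mem_refl _)) h

lemma mem_comp_ofMap {g : D ⟶ A} {x : T ⟶ D.carrier} {y : T ⟶ A.carrier} (h : Mem g.rel x y) :
    Mem (g ≫ ofMap A B f hf).rel x (y ≫ f) :=
  mem_comp_of_mem h (mem_ofMap.2 (B.isEquiv.mem_refl _))

end ofMap

/-! ### The unit functor and the quotient presentation of an object -/

/-- The object `(X, 1_X)`. -/
noncomputable abbrev discrete (X : C) : ExReg C := ⟨X, graph (𝟙 X), isEquiv_graph_id X⟩

/-- The graph of a morphism, as a morphism of the exact completion. -/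
noncomputable def graphHom {X Y : C} (f : X ⟶ Y) : discrete X ⟶ discrete Y := (unit C).map f

lemma mem_graphHom {X Y T : C} {f : X ⟶ Y} {x : T ⟶ X} {y : T ⟶ Y} :
    Mem (graphHom f).rel x y ↔ x ≫ f = y :=
  mem_graph

lemma mem_discrete {X T : C} {x y : T ⟶ X} : Mem (discrete X).rel x y ↔ x = y :=
  mem_graph_id

lemma mem_of_mem_discrete {X T : C} {x x' : T ⟶ X} (h : Mem (discrete X).rel x x') (A : ExReg C)
    (f : X ⟶ A.carrier) : Mem A.rel (x ≫ f) (x' ≫ f) := by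
  obtain rfl := mem_discrete.1 h
  exact A.isEquiv.mem_refl _

lemma graphHom_eq_ofMap {X Y : C} (f : X ⟶ Y) : graphHom f =
    ofMap (discrete X) (discrete Y) f (fun h => mem_of_mem_discrete h (discrete Y) f) :=
  hom_ext_of_mem fun _ _ h => mem_ofMap.2 (mem_discrete.2 (mem_graphHom.1 h))

lemma mem_graphHom_comp {X Y T : C} {f : X ⟶ Y} {B : ExReg C} {g : discrete Y ⟶ B}
    {x : T ⟶ X} {z : T ⟶ B.carrier} :
    Mem (graphHom f ≫ g).rel x z ↔ Mem g.rel (x ≫ f) z := by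
  rw [graphHom_eq_ofMap]
  exact mem_ofMap_comp

lemma graphHom_injective {X Y : C} {f g : X ⟶ Y} (h : graphHom f = graphHom g) : f = g := by
  have : Mem (graphHom g).rel (𝟙 X) f := by
    rw [← h]
    exact mem_graphHom.2 (Category.id_comp f)
  simpa using (mem_graphHom.1 this).symm

/-- Values in a discrete object are unique on the nose, so the local value of `g` at the generic
element `𝟙 X` descends along its cover to a morphism. -/
lemma graphHom_surjective {X Y : C} (g : discrete X ⟶ discrete Y) : ∃ f, graphHom f = g := by
  obtain ⟨T, e, he, y, h⟩ := Hom.exists_mem g (𝟙 X)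
  obtain ⟨f, hf⟩ := exists_desc e y fun a b hab => by
    have h₁ := h.precomp a
    have h₂ := h.precomp b
    rw [Category.comp_id] at h₁ h₂
    rw [hab] at h₁
    exact mem_discrete.1 (Hom.mem_unique g h₁ h₂)
  have hg : Mem g.rel (𝟙 X) f := Mem.of_cover e (by rwa [hf])
  refine ⟨f, hom_ext_of_mem fun x y h => ?_⟩
  have := hg.precomp x
  rwa [mem_graphHom.1 h, Category.comp_id] at this

instance : (unit C).Faithful where
  map_injective h := graphHom_injective h

instance : (unit C).Full where
  map_surjective g := graphHom_surjective g

/-- The quotient map `(X, 1_X) ⟶ (X, R)`. -/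
noncomputable def quotientMap (A : ExReg C) : discrete A.carrier ⟶ A :=
  ofMap _ _ (𝟙 A.carrier) (fun h => mem_of_mem_discrete h A _)

lemma mem_quotientMap {A : ExReg C} {T : C} {x y : T ⟶ A.carrier} :
    Mem (quotientMap A).rel x y ↔ Mem A.rel x y := by
  rw [quotientMap, mem_ofMap (hf := fun h => mem_of_mem_discrete h A _), Category.comp_id]

lemma mem_quotientMap_comp {A B : ExReg C} {f : A ⟶ B} {T : C} {x : T ⟶ A.carrier}
    {y : T ⟶ B.carrier} : Mem (quotientMap A ≫ f).rel x y ↔ Mem f.rel x y := by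
  rw [quotientMap, mem_ofMap_comp (hf := fun h => mem_of_mem_discrete h A _), Category.comp_id]

/-- Precomposition with the quotient map changes the domain but not the underlying relation, because
a morphism out of `A` already absorbs `A.rel`. Hence `quotientMap A` is epi. -/
lemma quotientMap_comp_rel {A B : ExReg C} (f : A ⟶ B) : (quotientMap A ≫ f).rel = f.rel := by
  apply le_antisymm <;> apply le_of_mem <;> intro T x y h
  · exact mem_quotientMap_comp.1 h
  · exact mem_quotientMap_comp.2 h

instance (A : ExReg C) : Epi (quotientMap A) where
  left_cancellation f g h := Hom.ext (by
    rw [← quotientMap_comp_rel f, h, quotientMap_comp_rel g])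

lemma quotientMap_condition (A : ExReg C) :
    graphHom (A.rel.arrow ≫ prod.fst) ≫ quotientMap A =
      graphHom (A.rel.arrow ≫ prod.snd) ≫ quotientMap A :=
  hom_ext_of_mem fun x y h => by
    rw [mem_graphHom_comp, mem_quotientMap] at *
    exact A.isEquiv.mem_trans (A.isEquiv.mem_symm ((mem_arrow A.rel).precomp x)) h

/-- The coequalizing condition says that `f.rel` absorbs `A.rel` on the left. This is the only law
of a morphism out of `A` that `f` does not already satisfy. -/
lemma exists_quotientMap_comp {A B : ExReg C} (f : discrete A.carrier ⟶ B)
    (h : graphHom (A.rel.arrow ≫ prod.fst) ≫ f = graphHom (A.rel.arrow ≫ prod.snd) ≫ f) :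
    ∃ g : A ⟶ B, quotientMap A ≫ g = f := by
  have left {T : C} {x x' : T ⟶ A.carrier} {y : T ⟶ B.carrier} (hx : Mem A.rel x x')
      (hy : Mem f.rel x' y) : Mem f.rel x y := by
    obtain ⟨t, rfl, rfl⟩ := mem_iff.1 hx
    rw [← mem_graphHom_comp] at hy ⊢
    rwa [h]
  exact ⟨Hom.ofMem f.rel left (Hom.mem_right f) (Hom.mem_unique f) (Hom.exists_mem f),
    Hom.ext (quotientMap_comp_rel _)⟩

instance (A : ExReg C) : IsRegularEpi (quotientMap A) where
  regularEpi := ⟨{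
    W := _
    left := _
    right := _
    w := quotientMap_condition A
    isColimit := Cofork.IsColimit.mk' _ fun s =>
      ⟨(exists_quotientMap_comp s.π s.condition).choose,
        (exists_quotientMap_comp s.π s.condition).choose_spec,
        fun {m} hm => by
          rw [← cancel_epi (quotientMap A), (exists_quotientMap_comp s.π s.condition).choose_spec]
          exact hm⟩ }⟩

/-- If `f` is injective and surjective for generalised elements, then it is an isomorphism. -/
lemma isIso_of_mem {A B : ExReg C} (f : A ⟶ B)
    (inj : ∀ {T : C} {x x' : T ⟶ A.carrier} {y : T ⟶ B.carrier},
      Mem f.rel x y → Mem f.rel x' y → Mem A.rel x x')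
    (surj : ∀ {T : C} (y : T ⟶ B.carrier), ∃ (T' : C) (e : T' ⟶ T) (_ : IsRegularEpi e)
      (x : T' ⟶ A.carrier), Mem f.rel x (e ≫ y)) : IsIso f := by
  let g : B ⟶ A := Hom.ofMem (opp f.rel)
    (fun h h' => mem_opp.2 (Hom.mem_right f (mem_opp.1 h') (B.isEquiv.mem_symm h)))
    (fun h h' => mem_opp.2 (Hom.mem_left f (A.isEquiv.mem_symm h') (mem_opp.1 h)))
    (fun h h' => inj (mem_opp.1 h) (mem_opp.1 h'))
    (fun y => by
      obtain ⟨T', e, he, x, h⟩ := surj y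
      exact ⟨T', e, he, x, mem_opp.2 h⟩)
  refine ⟨g, hom_ext_of_mem fun x x' h => ?_, hom_ext_of_mem fun y y' h => ?_⟩
  · obtain ⟨T', e, he, y, h₁, h₂⟩ := mem_comp.1 h
    exact Mem.of_cover e (inj h₁ (mem_opp.1 h₂))
  · obtain ⟨T', e, he, x, h₁, h₂⟩ := mem_comp.1 h
    exact Mem.of_cover e (Hom.mem_unique f (mem_opp.1 h₁) h₂)

end ExReg

/-- Existence and uniqueness of lifts are kept apart because lifts are obtained below without a
canonical choice, by totality of relations or by descent. -/
lemma CategoryTheory.IsPullback.of_exists {C : Type u} [Category.{v} C] {P A B D : C}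
    {fst : P ⟶ A} {snd : P ⟶ B} {f : A ⟶ D} {g : B ⟶ D} (w : fst ≫ f = snd ≫ g)
    (ex : ∀ {W : C} (a : W ⟶ A) (b : W ⟶ B), a ≫ f = b ≫ g →
      ∃ l : W ⟶ P, l ≫ fst = a ∧ l ≫ snd = b)
    (ext : ∀ {W : C} (l l' : W ⟶ P), l ≫ fst = l' ≫ fst → l ≫ snd = l' ≫ snd → l = l') :
    IsPullback fst snd f g where
  w := w
  isLimit' := ⟨PullbackCone.IsLimit.mk w (fun s => (ex s.fst s.snd s.condition).choose)
    (fun s => (ex s.fst s.snd s.condition).choose_spec.1)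
    (fun s => (ex s.fst s.snd s.condition).choose_spec.2)
    (fun s _ h₁ h₂ => ext _ _ (h₁.trans (ex s.fst s.snd s.condition).choose_spec.1.symm)
      (h₂.trans (ex s.fst s.snd s.condition).choose_spec.2.symm))⟩

/-! ### Pullbacks and the terminal object of the exact completion -/

namespace ExReg

variable {C : Type u} [Category.{v} C] [Regular C]

/-- A pullback in the exact completion is computed on the object of pairs with the same image,
with the relation induced from the product. -/
lemma isPullback_ofMap {P A B D : ExReg C} {f : A ⟶ D} {g : B ⟶ D}
    (p : P.carrier ⟶ A.carrier) (r : P.carrier ⟶ B.carrier)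
    (hP : ∀ {T : C} {t t' : T ⟶ P.carrier},
      Mem P.rel t t' ↔ Mem A.rel (t ≫ p) (t' ≫ p) ∧ Mem B.rel (t ≫ r) (t' ≫ r))
    (hfg : ∀ {T : C} (x : T ⟶ A.carrier) (y : T ⟶ B.carrier),
      Mem (comp f.rel (opp g.rel)) x y ↔ ∃ t : T ⟶ P.carrier, t ≫ p = x ∧ t ≫ r = y) :
    IsPullback (ofMap P A p fun h => (hP.1 h).1) (ofMap P B r fun h => (hP.1 h).2) f g := by
  refine IsPullback.of_exists ?_ (fun {W} a b hab => ?_) (fun {W} l l' h₁ h₂ => ?_)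
  · refine hom_ext_of_mem fun t z h => ?_
    rw [mem_ofMap_comp] at *
    obtain ⟨T', e, he, z', h₁, h₂⟩ := InternalRel.mem_comp.1 ((hfg _ _).2 ⟨t, rfl, rfl⟩)
    exact Mem.of_cover e (Hom.mem_right g (mem_opp.1 h₂) (Hom.mem_unique f h₁ (h.precomp e)))
  · let l : W ⟶ P := Hom.ofMem (inverseImage (𝟙 _) p a.rel ⊓ inverseImage (𝟙 _) r b.rel)
      (fun h h' => by
        simp only [mem_inf, mem_inverseImage, Category.comp_id] at *
        exact ⟨Hom.mem_left a h h'.1, Hom.mem_left b h h'.2⟩)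
      (fun h h' => by
        simp only [mem_inf, mem_inverseImage, Category.comp_id] at *
        exact ⟨Hom.mem_right a h.1 (hP.1 h').1, Hom.mem_right b h.2 (hP.1 h').2⟩)
      (fun h h' => by
        simp only [mem_inf, mem_inverseImage, Category.comp_id] at *
        exact hP.2 ⟨Hom.mem_unique a h.1 h'.1, Hom.mem_unique b h.2 h'.2⟩)
      (fun w => by
        -- Totality of the lift: a value `z` of `f` at a value `x` of `a` is a value of `a ≫ f = b ≫
        -- g` at `w`, so it is also a value of `g` at some value `y` of `b`. The pair `(x, y)` then
        -- comes from `P`.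
        obtain ⟨T₁, e₁, _, x, hx⟩ := Hom.exists_mem a w
        obtain ⟨T₂, e₂, _, z, hz⟩ := Hom.exists_mem f x
        have hw : Mem (a ≫ f).rel (e₂ ≫ e₁ ≫ w) z := mem_comp_of_mem (hx.precomp e₂) hz
        rw [hab] at hw
        obtain ⟨T₃, e₃, _, y, hy, hz'⟩ := mem_comp.1 hw
        obtain ⟨t, h₁, h₂⟩ := (hfg (e₃ ≫ e₂ ≫ x) y).1
          (InternalRel.mem_comp_of_mem (hz.precomp e₃) (mem_opp.2 hz'))
        have := isRegularEpi_comp e₂ e₁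
        refine ⟨T₃, e₃ ≫ e₂ ≫ e₁, isRegularEpi_comp _ _, t, ?_⟩
        simp only [mem_inf, mem_inverseImage, Category.comp_id, h₁, h₂]
        exact ⟨by simpa using hx.precomp (e₃ ≫ e₂), by simpa using hy⟩)
    have hl {T : C} {w : T ⟶ W.carrier} {t : T ⟶ P.carrier} :
        Mem l.rel w t ↔ Mem a.rel w (t ≫ p) ∧ Mem b.rel w (t ≫ r) := by
      change Mem (_ ⊓ _) w t ↔ _
      simp only [mem_inf, mem_inverseImage, Category.comp_id]
    refine ⟨l, hom_ext_of_mem fun w x h => ?_, hom_ext_of_mem fun w x h => ?_⟩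
    · obtain ⟨T', e, he, t, h₁, h₂⟩ := mem_comp.1 h
      exact Mem.of_cover e (Hom.mem_right a (hl.1 h₁).1 (mem_ofMap.1 h₂))
    · obtain ⟨T', e, he, t, h₁, h₂⟩ := mem_comp.1 h
      exact Mem.of_cover e (Hom.mem_right b (hl.1 h₁).2 (mem_ofMap.1 h₂))
  · refine hom_ext_of_mem fun w t h => ?_
    obtain ⟨T', e, he, t', h'⟩ := Hom.exists_mem l' w
    have k₁ := mem_comp_ofMap (hf := fun h => (hP.1 h).1) (h.precomp e)
    have k₂ := mem_comp_ofMap (hf := fun h => (hP.1 h).2) (h.precomp e)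
    rw [h₁] at k₁
    rw [h₂] at k₂
    have k₁' := Hom.mem_unique _ (mem_comp_ofMap (hf := fun h => (hP.1 h).1) h') k₁
    have k₂' := Hom.mem_unique _ (mem_comp_ofMap (hf := fun h => (hP.1 h).2) h') k₂
    exact Mem.of_cover e (Hom.mem_right l' h' (hP.2 ⟨k₁', k₂'⟩))

section Pullback

variable {A B D : ExReg C} (f : A ⟶ D) (g : B ⟶ D)

/-- The first projection of the object of pairs with the same image. -/
noncomputable abbrev pullbackFst :
    (Subobject.underlying.obj (comp f.rel (opp g.rel)) : C) ⟶ A.carrier :=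
  (comp f.rel (opp g.rel)).arrow ≫ prod.fst

/-- The second projection of the object of pairs with the same image. -/
noncomputable abbrev pullbackSnd :
    (Subobject.underlying.obj (comp f.rel (opp g.rel)) : C) ⟶ B.carrier :=
  (comp f.rel (opp g.rel)).arrow ≫ prod.snd

/-- The relation of the pullback of `f` and `g`. -/
noncomputable def pullbackRel : Relation (Subobject.underlying.obj (comp f.rel (opp g.rel)) : C)
    (Subobject.underlying.obj (comp f.rel (opp g.rel)) : C) :=
  inverseImage (pullbackFst f g) (pullbackFst f g) A.rel ⊓
    inverseImage (pullbackSnd f g) (pullbackSnd f g) B.rel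

variable {f g} in
lemma mem_pullbackRel {T : C} {t t' : T ⟶ (Subobject.underlying.obj (comp f.rel (opp g.rel)) : C)} :
    Mem (pullbackRel f g) t t' ↔ Mem A.rel (t ≫ pullbackFst f g) (t' ≫ pullbackFst f g) ∧
      Mem B.rel (t ≫ pullbackSnd f g) (t' ≫ pullbackSnd f g) := by
  rw [pullbackRel, mem_inf, mem_inverseImage, mem_inverseImage]

/-- The pullback of `f` and `g` in the exact completion. -/
noncomputable abbrev pullbackObj : ExReg C where
  carrier := Subobject.underlying.obj (comp f.rel (opp g.rel))
  rel := pullbackRel f g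
  isEquiv := isEquiv_of_mem
    (fun _ => mem_pullbackRel.2 ⟨A.isEquiv.mem_refl _, B.isEquiv.mem_refl _⟩)
    (fun _ _ h => mem_pullbackRel.2 ⟨A.isEquiv.mem_symm (mem_pullbackRel.1 h).1,
      B.isEquiv.mem_symm (mem_pullbackRel.1 h).2⟩)
    (fun _ _ _ h h' => mem_pullbackRel.2
      ⟨A.isEquiv.mem_trans (mem_pullbackRel.1 h).1 (mem_pullbackRel.1 h').1,
      B.isEquiv.mem_trans (mem_pullbackRel.1 h).2 (mem_pullbackRel.1 h').2⟩)

lemma isPullback_pullbackObj : IsPullback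
    (ofMap (pullbackObj f g) A (pullbackFst f g) fun h => (mem_pullbackRel.1 h).1)
    (ofMap (pullbackObj f g) B (pullbackSnd f g) fun h => (mem_pullbackRel.1 h).2) f g :=
  isPullback_ofMap _ _ mem_pullbackRel fun _ _ => mem_iff

instance : HasPullbacks (ExReg C) :=
  have (X Y Z : ExReg C) (f : X ⟶ Z) (g : Y ⟶ Z) : HasLimit (cospan f g) :=
    (isPullback_pullbackObj f g).hasPullback
  hasPullbacks_of_hasLimit_cospan _

end Pullback

/-- A morphism `M` of the exact completion, as a relation, is the pullback of `M` and the quotient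
map of its target. -/
lemma isPullback_quotientMap {A B : ExReg C} (f : A ⟶ B) : IsPullback
    (graphHom (f.rel.arrow ≫ prod.fst)) (graphHom (f.rel.arrow ≫ prod.snd))
    (quotientMap A ≫ f) (quotientMap B) := by
  rw [graphHom_eq_ofMap, graphHom_eq_ofMap]
  -- The relation induced on the carrier is equality, because both sources are discrete and the
  -- projections of `f.rel` are jointly monic.
  refine isPullback_ofMap (P := discrete _) _ _ (fun {T t t'} => ?_) fun x y => ?_
  · rw [mem_discrete, mem_discrete, mem_discrete]
    refine ⟨fun h => by simp [h], fun h => ?_⟩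
    rw [← cancel_mono f.rel.arrow]
    apply hom_ext_prod
    · simpa using h.1
    · simpa using h.2
  · rw [quotientMap_comp_rel, ← mem_iff]
    constructor
    · intro h
      obtain ⟨T', e, he, z, h₁, h₂⟩ := InternalRel.mem_comp.1 h
      rw [mem_opp, mem_quotientMap] at h₂
      exact Mem.of_cover e (Hom.mem_right f h₁ (B.isEquiv.mem_symm h₂))
    · intro h
      exact InternalRel.mem_comp_of_mem h
        (mem_opp.2 (mem_quotientMap.2 (B.isEquiv.mem_refl y)))

/-- The object `(1, 1)` is terminal. -/
noncomputable def isTerminalDiscrete : IsTerminal (discrete (⊤_ C)) :=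
  IsTerminal.ofUniqueHom
    (fun A => ofMap A (discrete (⊤_ C)) (terminal.from _)
      fun _ => mem_discrete.2 (terminal.hom_ext _ _))
    (fun _ _ => hom_ext_of_mem fun _ _ _ => mem_ofMap.2 (mem_discrete.2 (terminal.hom_ext _ _)))

instance : HasTerminal (ExReg C) := isTerminalDiscrete.hasTerminal

/-! ### Images, regular epimorphisms and subobjects of discrete objects -/

section Image

variable {A B : ExReg C} (f : A ⟶ B)

/-- The inclusion of the subobject of `B.carrier` of all values of `f`. -/
noncomputable abbrev rangeι : image (f.rel.arrow ≫ prod.snd) ⟶ B.carrier :=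
  image.ι (f.rel.arrow ≫ prod.snd)

/-- The image of `f` in the exact completion. -/
noncomputable abbrev imageObj : ExReg C where
  carrier := image (f.rel.arrow ≫ prod.snd)
  rel := inverseImage (rangeι f) (rangeι f) B.rel
  isEquiv := isEquiv_of_mem
    (fun _ => mem_inverseImage.2 (B.isEquiv.mem_refl _))
    (fun _ _ h => mem_inverseImage.2 (B.isEquiv.mem_symm (mem_inverseImage.1 h)))
    (fun _ _ _ h h' => mem_inverseImage.2
      (B.isEquiv.mem_trans (mem_inverseImage.1 h) (mem_inverseImage.1 h')))

/-- The inclusion of the image of `f`. -/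
noncomputable def imageInclusion : imageObj f ⟶ B :=
  ofMap (imageObj f) B (rangeι f) fun h => mem_inverseImage.1 h

/-- The corestriction of `f` to its image. -/
noncomputable def toImage : A ⟶ imageObj f :=
  Hom.ofMem (inverseImage (𝟙 _) (rangeι f) f.rel)
    (fun h h' => by
      rw [mem_inverseImage, Category.comp_id] at *
      exact Hom.mem_left f h h')
    (fun h h' => by
      rw [mem_inverseImage, Category.comp_id] at *
      exact Hom.mem_right f h h')
    (fun h h' => by
      rw [mem_inverseImage, Category.comp_id] at *
      exact Hom.mem_unique f h h')
    (fun x => by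
      obtain ⟨T', e, he, y, h⟩ := Hom.exists_mem f x
      obtain ⟨t, h₁, h₂⟩ := mem_iff.1 h
      refine ⟨T', e, he, t ≫ factorThruImage _, mem_inverseImage.2 ?_⟩
      simp only [Category.assoc, image.fac, Category.comp_id]
      exact mem_iff.2 ⟨t, h₁, rfl⟩)

variable {f} {T : C}

lemma mem_toImage {x : T ⟶ A.carrier} {y : T ⟶ image (f.rel.arrow ≫ prod.snd)} :
    Mem (toImage f).rel x y ↔ Mem f.rel x (y ≫ rangeι f) := by
  change Mem (inverseImage (𝟙 _) (rangeι f) f.rel) x y ↔ _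
  rw [mem_inverseImage, Category.comp_id]

lemma exists_mem_rangeι (y : T ⟶ image (f.rel.arrow ≫ prod.snd)) :
    ∃ (T' : C) (e : T' ⟶ T) (_ : IsRegularEpi e) (x : T' ⟶ A.carrier),
      Mem f.rel x (e ≫ y ≫ rangeι f) := by
  have : IsRegularEpi (factorThruImage (f.rel.arrow ≫ prod.snd)) := isRegularEpi_of_strongEpi _
  refine ⟨_, pullback.fst y (factorThruImage (f.rel.arrow ≫ prod.snd)), inferInstance,
    pullback.snd y (factorThruImage (f.rel.arrow ≫ prod.snd)) ≫ f.rel.arrow ≫ prod.fst,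
    mem_iff.2 ⟨pullback.snd y (factorThruImage (f.rel.arrow ≫ prod.snd)), rfl, ?_⟩⟩
  rw [pullback.condition_assoc, image.fac]

variable (f)

lemma toImage_imageInclusion : toImage f ≫ imageInclusion f = f :=
  hom_ext_of_mem fun x y h => by
    obtain ⟨T', e, he, z, h₁, h₂⟩ := mem_comp.1 h
    exact Mem.of_cover e (Hom.mem_right f (mem_toImage.1 h₁)
      ((mem_ofMap (hf := fun h => mem_inverseImage.1 h)).1 h₂))

instance : Mono (imageInclusion f) where
  right_cancellation g h hgh := hom_ext_of_mem fun x y hg => by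
    obtain ⟨T', e, he, y', hh⟩ := Hom.exists_mem h x
    have k₁ := mem_comp_ofMap (hf := fun h => mem_inverseImage.1 h) (hg.precomp e)
    have k₂ := mem_comp_ofMap (hf := fun h => mem_inverseImage.1 h) hh
    change Mem (g ≫ imageInclusion f).rel _ _ at k₁
    rw [hgh] at k₁
    exact Mem.of_cover e (Hom.mem_right h hh (mem_inverseImage.2 (Hom.mem_unique _ k₂ k₁)))

/-- Regular epimorphisms in the exact completion are surjective on generalised elements. -/
lemma exists_mem_of_isRegularEpi [IsRegularEpi f] (y : T ⟶ B.carrier) :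
    ∃ (T' : C) (e : T' ⟶ T) (_ : IsRegularEpi e) (x : T' ⟶ A.carrier), Mem f.rel x (e ≫ y) := by
  -- A strong epimorphism that factors through the mono `imageInclusion f` makes it invertible. So
  -- every `y` is locally equivalent to an element of the range, and those are locally values of
  -- `f`.
  have : StrongEpi (toImage f ≫ imageInclusion f) := by
    rw [toImage_imageInclusion]
    infer_instance
  have : StrongEpi (imageInclusion f) := strongEpi_of_strongEpi (toImage f) _
  have : IsIso (imageInclusion f) := isIso_of_mono_of_strongEpi _
  obtain ⟨T₁, e₁, _, z, hz⟩ := Hom.exists_mem (inv (imageInclusion f)) y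
  have h₁ := mem_comp_ofMap (hf := fun h => mem_inverseImage.1 h) hz
  change Mem (inv (imageInclusion f) ≫ imageInclusion f).rel _ _ at h₁
  rw [IsIso.inv_hom_id, mem_id] at h₁
  obtain ⟨T₂, e₂, _, x, hx⟩ := exists_mem_rangeι z
  refine ⟨T₂, e₂ ≫ e₁, isRegularEpi_comp _ _, x, ?_⟩
  rw [Category.assoc]
  exact Hom.mem_right f hx (B.isEquiv.mem_symm (h₁.precomp e₂))

end Image

lemma eq_discrete {A : ExReg C} (h : A.rel = graph (𝟙 A.carrier)) : A = discrete A.carrier := by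
  obtain ⟨X, R, hR⟩ := A
  change R = graph (𝟙 X) at h
  subst h
  rfl

/-- The exact completion is closed under subobjects of objects in the image of the unit. -/
lemma exists_iso_discrete_of_mono {A : ExReg C} {Y : C} (m : A ⟶ discrete Y) [Mono m] :
    ∃ X : C, Nonempty (discrete X ≅ A) := by
  -- The mono `m` is cancelled against the two morphisms `discrete T ⟶ A` represented by `x` and
  -- `x'`; evaluation at `𝟙 T` then relates `x` to `x'`.
  have inj {T : C} {x x' : T ⟶ A.carrier} {y : T ⟶ Y} (h : Mem m.rel x y)
      (h' : Mem m.rel x' y) : Mem A.rel x x' := by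
    have : graphHom x ≫ quotientMap A = graphHom x' ≫ quotientMap A := by
      rw [← cancel_mono m]
      refine hom_ext_of_mem fun t z hz => ?_
      rw [Category.assoc, mem_graphHom_comp, mem_quotientMap_comp] at *
      have := Hom.mem_unique m (h.precomp t) hz
      rw [mem_discrete] at this
      rw [← this]
      exact h'.precomp t
    have h₁ : Mem (graphHom x ≫ quotientMap A).rel (𝟙 T) x' := by
      rw [this, mem_graphHom_comp, mem_quotientMap, Category.id_comp]
      exact A.isEquiv.mem_refl _
    rwa [mem_graphHom_comp, mem_quotientMap, Category.id_comp] at h₁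
  have : IsIso (toImage m) := by
    refine isIso_of_mem _ (fun h h' => inj (mem_toImage.1 h) (mem_toImage.1 h')) fun y => ?_
    obtain ⟨T', e, he, x, h⟩ := exists_mem_rangeι y
    exact ⟨T', e, he, x, mem_toImage.2 (by rwa [Category.assoc])⟩
  -- Equality on `Y`, restricted along the mono `rangeι m`, is again equality.
  have hm : (imageObj m).rel = graph (𝟙 _) := by
    apply le_antisymm <;> apply le_of_mem <;> intro T x y h
    · rw [mem_inverseImage, mem_discrete, cancel_mono] at h
      exact mem_graph_id.2 h
    · rw [mem_graph_id.1 h]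
      exact (imageObj m).isEquiv.mem_refl y
  exact ⟨_, ⟨eqToIso (eq_discrete hm).symm ≪≫ (asIso (toImage m)).symm⟩⟩

end ExReg

/-! ### The image of a relation under a functor -/

namespace InternalRel

section MapMem

variable {C : Type u₁} [Category.{v₁} C] {D : Type u₂} [Category.{v₂} D]

/-- The generalised elements `x : T ⟶ F X` and `y : T ⟶ F Y` are related by the image of the
relation `R` under `F`. -/
def MapMem [HasFiniteLimits C] (F : C ⥤ D) {X Y : C} (R : Relation X Y) {T : D} (x : T ⟶ F.obj X)
    (y : T ⟶ F.obj Y) : Prop :=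
  ∃ t : T ⟶ F.obj (R : C), t ≫ F.map (R.arrow ≫ prod.fst) = x ∧
    t ≫ F.map (R.arrow ≫ prod.snd) = y

section FiniteLimits

variable [HasFiniteLimits C] (F : C ⥤ D)

/-- The transfer principle: combined with generic pairs such as `mem_arrow`, it carries facts about
relations in `C` over to `D`. -/
lemma MapMem.of_mem {X Y U : C} {R : Relation X Y} {a : U ⟶ X} {b : U ⟶ Y} (h : Mem R a b) {T : D}
    (t : T ⟶ F.obj U) : MapMem F R (t ≫ F.map a) (t ≫ F.map b) := by
  obtain ⟨r, rfl, rfl⟩ := mem_iff.1 h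
  exact ⟨t ≫ F.map r, by simp, by simp⟩

variable {F}

lemma MapMem.mono {X Y : C} {R S : Relation X Y} {T : D} {x : T ⟶ F.obj X} {y : T ⟶ F.obj Y}
    (h : MapMem F R x y) (le : R ≤ S) : MapMem F S x y := by
  obtain ⟨t, rfl, rfl⟩ := h
  exact .of_mem F (le_iff_mem_arrow.1 le) t

lemma MapMem.precomp {X Y : C} {R : Relation X Y} {T T' : D} {x : T ⟶ F.obj X} {y : T ⟶ F.obj Y}
    (h : MapMem F R x y) (e : T' ⟶ T) : MapMem F R (e ≫ x) (e ≫ y) := by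
  obtain ⟨t, rfl, rfl⟩ := h
  exact ⟨e ≫ t, by simp, by simp⟩

lemma mapMem_opp {X Y : C} {R : Relation X Y} {T : D} {x : T ⟶ F.obj X} {y : T ⟶ F.obj Y} :
    MapMem F (opp R) y x ↔ MapMem F R x y := by
  constructor
  · rintro ⟨t, rfl, rfl⟩
    exact .of_mem F (mem_opp.1 (mem_arrow _)) t
  · rintro ⟨t, rfl, rfl⟩
    exact .of_mem F (mem_opp.2 (mem_arrow _)) t

lemma mapMem_graph {X Y : C} {f : X ⟶ Y} {T : D} {x : T ⟶ F.obj X} {y : T ⟶ F.obj Y} :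
    MapMem F (graph f) x y ↔ x ≫ F.map f = y := by
  constructor
  · rintro ⟨t, rfl, rfl⟩
    rw [Category.assoc, ← F.map_comp, mem_graph.1 (mem_arrow (graph f))]
  · rintro rfl
    simpa using MapMem.of_mem F (mem_graph.2 (Category.id_comp f)) x

variable [PreservesFiniteLimits F]

lemma map_prod_hom_ext {X Y : C} {T : D} {a b : T ⟶ F.obj (X ⨯ Y)}
    (h₁ : a ≫ F.map prod.fst = b ≫ F.map prod.fst)
    (h₂ : a ≫ F.map prod.snd = b ≫ F.map prod.snd) : a = b := by
  rw [← cancel_mono (PreservesLimitPair.iso F X Y).hom]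
  apply Limits.prod.hom_ext <;> simpa

lemma exists_map_prod_lift {X Y : C} {T : D} (x : T ⟶ F.obj X) (y : T ⟶ F.obj Y) :
    ∃ t : T ⟶ F.obj (X ⨯ Y), t ≫ F.map prod.fst = x ∧ t ≫ F.map prod.snd = y :=
  ⟨prod.lift x y ≫ (PreservesLimitPair.iso F X Y).inv, by simp [prod.lift_fst],
    by simp [prod.lift_snd]⟩

lemma exists_map_pullback_lift {X Y Z : C} {f : X ⟶ Z} {g : Y ⟶ Z} {T : D} (x : T ⟶ F.obj X)
    (y : T ⟶ F.obj Y) (h : x ≫ F.map f = y ≫ F.map g) : ∃ t : T ⟶ F.obj (pullback f g),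
      t ≫ F.map (pullback.fst f g) = x ∧ t ≫ F.map (pullback.snd f g) = y :=
  have sq := (IsPullback.of_hasPullback f g).map F
  ⟨sq.lift x y h, sq.lift_fst _ _ _, sq.lift_snd _ _ _⟩

lemma map_rel_hom_ext {X Y : C} {R : Relation X Y} {T : D} {a b : T ⟶ F.obj (R : C)}
    (h₁ : a ≫ F.map (R.arrow ≫ prod.fst) = b ≫ F.map (R.arrow ≫ prod.fst))
    (h₂ : a ≫ F.map (R.arrow ≫ prod.snd) = b ≫ F.map (R.arrow ≫ prod.snd)) : a = b := by
  rw [← cancel_mono (F.map R.arrow)]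
  apply map_prod_hom_ext
  · simpa using h₁
  · simpa using h₂

/-- As `F` preserves finite limits, the projections of `F R` are jointly monic, so the witness over
the cover is compatible on the kernel pair and descends. -/
lemma MapMem.of_cover {X Y : C} {R : Relation X Y} {T T' : D} {x : T ⟶ F.obj X} {y : T ⟶ F.obj Y}
    (e : T' ⟶ T) [IsRegularEpi e] (h : MapMem F R (e ≫ x) (e ≫ y)) : MapMem F R x y := by
  obtain ⟨t', h₁, h₂⟩ := h
  obtain ⟨t, rfl⟩ := exists_desc e t' fun a b hab => map_rel_hom_ext
    (by rw [Category.assoc, Category.assoc, h₁, reassoc_of% hab])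
    (by rw [Category.assoc, Category.assoc, h₂, reassoc_of% hab])
  exact ⟨t, by simpa [cancel_epi] using h₁, by simpa [cancel_epi] using h₂⟩

lemma mapMem_inf {X Y : C} {R S : Relation X Y} {T : D} {x : T ⟶ F.obj X} {y : T ⟶ F.obj Y} :
    MapMem F (R ⊓ S) x y ↔ MapMem F R x y ∧ MapMem F S x y := by
  refine ⟨fun h => ⟨h.mono inf_le_left, h.mono inf_le_right⟩, ?_⟩
  rintro ⟨⟨r, rfl, rfl⟩, s, h₁, h₂⟩
  obtain ⟨t, rfl, rfl⟩ := exists_map_pullback_lift (f := R.arrow) (g := S.arrow) r s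
    (map_prod_hom_ext (by simpa using h₁.symm) (by simpa using h₂.symm))
  have : Mem (R ⊓ S) (pullback.fst R.arrow S.arrow ≫ R.arrow ≫ prod.fst)
      (pullback.fst R.arrow S.arrow ≫ R.arrow ≫ prod.snd) :=
    mem_inf.2 ⟨(mem_arrow R).precomp _, by
      rw [pullback.condition_assoc, pullback.condition_assoc]
      exact (mem_arrow S).precomp _⟩
  simpa using MapMem.of_mem F this t

end FiniteLimits

variable [Regular C] [Regular D] {F : C ⥤ D} [PreservesFiniteLimits F]

omit [Regular D] in
lemma mapMem_comp_of_mapMem {X Y Z : C} {R : Relation X Y} {S : Relation Y Z} {T : D}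
    {x : T ⟶ F.obj X} {y : T ⟶ F.obj Y} {z : T ⟶ F.obj Z} (h : MapMem F R x y)
    (h' : MapMem F S y z) : MapMem F (comp R S) x z := by
  obtain ⟨r, rfl, rfl⟩ := h
  obtain ⟨s, h₁, rfl⟩ := h'
  obtain ⟨t, rfl, rfl⟩ := exists_map_pullback_lift r s h₁.symm
  have : Mem (comp R S) (pullback.fst (R.arrow ≫ prod.snd) (S.arrow ≫ prod.fst) ≫
      R.arrow ≫ prod.fst) (pullback.snd (R.arrow ≫ prod.snd) (S.arrow ≫ prod.fst) ≫
      S.arrow ≫ prod.snd) :=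
    mem_comp_of_mem ((mem_arrow R).precomp _) (by
      rw [pullback.condition]
      exact (mem_arrow S).precomp _)
  simpa using MapMem.of_mem F this t

/-- Composition uses images, so finding a middle element requires `F` to preserve regular
epimorphisms: the cover carrying it in `C` stays a cover in `D`. The converse needs only finite
limits. -/
lemma mapMem_comp (hF : IsRegularFunctor F) {X Y Z : C} {R : Relation X Y} {S : Relation Y Z}
    {T : D} {x : T ⟶ F.obj X} {z : T ⟶ F.obj Z} :
    MapMem F (comp R S) x z ↔ ∃ (T' : D) (e : T' ⟶ T) (_ : IsRegularEpi e) (y : T' ⟶ F.obj Y),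
      MapMem F R (e ≫ x) y ∧ MapMem F S y (e ≫ z) := by
  constructor
  · rintro ⟨t, rfl, rfl⟩
    obtain ⟨U, e, he, y, h₁, h₂⟩ := mem_comp.1 (mem_arrow (comp R S))
    have := hF.map_isRegularEpi e he
    refine ⟨_, pullback.fst t (F.map e), inferInstance, pullback.snd t (F.map e) ≫ F.map y, ?_, ?_⟩
    · rw [pullback.condition_assoc, ← F.map_comp]
      exact .of_mem F h₁ _
    · rw [pullback.condition_assoc, ← F.map_comp]
      exact .of_mem F h₂ _
  · rintro ⟨T', e, _, y, h₁, h₂⟩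
    exact .of_cover e (mapMem_comp_of_mapMem h₁ h₂)

/-- Since `inverseImage` is a composite with graphs and their opposites, its behaviour under `F`
follows from theirs. -/
lemma mapMem_inverseImage (hF : IsRegularFunctor F) {X Y X' Y' : C} {f : X' ⟶ X} {g : Y' ⟶ Y}
    {R : Relation X Y} {T : D} {x : T ⟶ F.obj X'} {y : T ⟶ F.obj Y'} :
    MapMem F (inverseImage f g R) x y ↔ MapMem F R (x ≫ F.map f) (y ≫ F.map g) := by
  constructor
  · intro h
    obtain ⟨T', e, he, x', h₁, h₂⟩ := (mapMem_comp hF).1 h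
    obtain ⟨T'', e', he', y', h₃, h₄⟩ := (mapMem_comp hF).1 h₂
    rw [mapMem_graph] at h₁
    rw [mapMem_opp, mapMem_graph] at h₄
    have := isRegularEpi_comp e' e
    apply MapMem.of_cover (e' ≫ e)
    simpa [← h₁, ← h₄] using h₃
  · intro h
    exact mapMem_comp_of_mapMem (mapMem_graph.2 rfl)
      (mapMem_comp_of_mapMem h (mapMem_opp.2 (mapMem_graph.2 rfl)))

namespace IsEquiv

omit [Regular D] [PreservesFiniteLimits F]

variable {X : C} {R : Relation X X} (h : IsEquiv R) {T : D}
include h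

lemma mapMem_refl (x : T ⟶ F.obj X) : MapMem F R x x :=
  (mapMem_graph.2 (by simp)).mono h.refl

lemma mapMem_symm {x y : T ⟶ F.obj X} (hxy : MapMem F R x y) : MapMem F R y x :=
  mapMem_opp.1 (hxy.mono h.symm)

lemma mapMem_trans [PreservesFiniteLimits F] {x y z : T ⟶ F.obj X} (hxy : MapMem F R x y)
    (hyz : MapMem F R y z) : MapMem F R x z :=
  (mapMem_comp_of_mapMem hxy hyz).mono h.trans

end IsEquiv

end MapMem

end InternalRel

/-! ### Presentations by quotients and the construction of the induced functor -/

namespace ExReg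

variable {C : Type u₁} [Category.{v₁} C] [Regular C] {D : Type u₂} [Category.{v₂} D]

namespace Hom

variable {F : C ⥤ D} [PreservesFiniteLimits F] {A B : ExReg C} (f : A ⟶ B) {T : D}

lemma mapMem_left {x x' : T ⟶ F.obj A.carrier} {y : T ⟶ F.obj B.carrier}
    (h : MapMem F A.rel x x') (h' : MapMem F f.rel x' y) : MapMem F f.rel x y := by
  rw [← f.left_comp]
  exact mapMem_comp_of_mapMem h h'

lemma mapMem_right {x : T ⟶ F.obj A.carrier} {y y' : T ⟶ F.obj B.carrier}
    (h : MapMem F f.rel x y) (h' : MapMem F B.rel y y') : MapMem F f.rel x y' := by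
  rw [← f.comp_right]
  exact mapMem_comp_of_mapMem h h'

lemma mapMem_unique {x : T ⟶ F.obj A.carrier} {y y' : T ⟶ F.obj B.carrier}
    (h : MapMem F f.rel x y) (h' : MapMem F f.rel x y') : MapMem F B.rel y y' :=
  (mapMem_comp_of_mapMem (mapMem_opp.2 h) h').mono f.singleValued

omit [PreservesFiniteLimits F] in
lemma exists_mapMem [Regular D] (hF : IsRegularFunctor F) (x : T ⟶ F.obj A.carrier) :
    ∃ (T' : D) (e : T' ⟶ T) (_ : IsRegularEpi e) (y : T' ⟶ F.obj B.carrier),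
      MapMem F f.rel (e ≫ x) y := by
  obtain ⟨U, e, he, y, h⟩ := exists_mem f (𝟙 A.carrier)
  have := hF.map_isRegularEpi e he
  refine ⟨_, pullback.fst x (F.map e), inferInstance, pullback.snd x (F.map e) ≫ F.map y, ?_⟩
  rw [Category.comp_id] at h
  rw [pullback.condition]
  exact .of_mem F h _

end Hom

/-- The functor `G` on the exact completion sends `(X, R)` to the quotient, by `q (X, R)`, of `F X`
by the image of `R`, and a morphism to the morphism induced on quotients. -/
structure IsPresentation (F : C ⥤ D) (G : ExReg C ⥤ D)
    (q : ∀ A : ExReg C, F.obj A.carrier ⟶ G.obj A) : Prop where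
  isRegularEpi (A : ExReg C) : IsRegularEpi (q A)
  mapMem_iff {A B : ExReg C} (f : A ⟶ B) {T : D} (x : T ⟶ F.obj A.carrier)
    (y : T ⟶ F.obj B.carrier) : MapMem F f.rel x y ↔ x ≫ q A ≫ G.map f = y ≫ q B

/-- `G` preserves the regular epimorphism `quotientMap A` and the pullback square of
`isPullback_quotientMap`; `α` identifies the images of discrete objects with values of `F`. -/
lemma exists_isPresentation [Regular D] {F : C ⥤ D} {G : ExReg C ⥤ D} (hG : IsRegularFunctor G)
    (α : ExReg.unit C ⋙ G ≅ F) : ∃ q, IsPresentation F G q := by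
  have := hG.preservesFiniteLimits
  let β (X : C) : F.obj X ≅ G.obj (discrete X) := (α.app X).symm
  have hβ {X Y : C} (f : X ⟶ Y) : F.map f ≫ (β Y).hom = (β X).hom ≫ G.map (graphHom f) :=
    α.inv.naturality f
  refine ⟨fun A => (β _).hom ≫ G.map (quotientMap A), fun A => ?_, fun {A B} f T x y => ?_⟩
  · have := hG.map_isRegularEpi (quotientMap A) inferInstance
    exact isRegularEpi_comp _ _
  · have sq := (isPullback_quotientMap f).map G
    simp only [Category.assoc, ← G.map_comp]
    constructor
    · rintro ⟨t, rfl, rfl⟩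
      simp only [Category.assoc, reassoc_of% hβ]
      rw [sq.w]
    · intro h
      refine ⟨sq.lift (x ≫ (β _).hom) (y ≫ (β _).hom) (by simpa using h) ≫ (β _).inv, ?_, ?_⟩
      · rw [← cancel_mono (β _).hom]
        simp only [Category.assoc, hβ, Iso.inv_hom_id_assoc, sq.lift_fst]
      · rw [← cancel_mono (β _).hom]
        simp only [Category.assoc, hβ, Iso.inv_hom_id_assoc, sq.lift_snd]

section Quotients

variable [Regular D] {F : C ⥤ D} (hF : IsRegularFunctor F) (Q : ExReg C → D)
  (q : ∀ A : ExReg C, F.obj A.carrier ⟶ Q A) [∀ A, IsRegularEpi (q A)]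
  (hq : ∀ (A : ExReg C) {T : D} (x x' : T ⟶ F.obj A.carrier),
    MapMem F A.rel x x' ↔ x ≫ q A = x' ≫ q A)
include hF

/-- `f` has a value over some cover `e` of `F.obj A.carrier`; both morphisms are determined there,
and `e ≫ q A` is epi. -/
lemma eq_of_mapMem {A B : ExReg C} (f : A ⟶ B) {g g' : Q A ⟶ Q B}
    (h : ∀ {T : D} (x : T ⟶ F.obj A.carrier) (y : T ⟶ F.obj B.carrier),
      MapMem F f.rel x y → x ≫ q A ≫ g = y ≫ q B)
    (h' : ∀ {T : D} (x : T ⟶ F.obj A.carrier) (y : T ⟶ F.obj B.carrier),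
      MapMem F f.rel x y → x ≫ q A ≫ g' = y ≫ q B) : g = g' := by
  obtain ⟨T, e, he, y, hy⟩ := Hom.exists_mapMem f hF (𝟙 _)
  rw [Category.comp_id] at hy
  rw [← cancel_epi (q A), ← cancel_epi e, h _ _ hy, h' _ _ hy]

include hq

/-- The class of a local value of `f` depends only on the class of the argument, so it descends
along the composite cover `e ≫ q A`. -/
lemma exists_of_mapMem {A B : ExReg C} (f : A ⟶ B) : ∃ g : Q A ⟶ Q B,
    ∀ {T : D} (x : T ⟶ F.obj A.carrier) (y : T ⟶ F.obj B.carrier),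
      MapMem F f.rel x y → x ≫ q A ≫ g = y ≫ q B := by
  have := hF.preservesFiniteLimits
  obtain ⟨T, e, he, y, hy⟩ := Hom.exists_mapMem f hF (𝟙 _)
  rw [Category.comp_id] at hy
  have := isRegularEpi_comp e (q A)
  obtain ⟨g, hg⟩ := exists_desc (e ≫ q A) (y ≫ q B) fun a b hab => by
    simp only [← Category.assoc] at hab ⊢
    rw [← hq] at hab ⊢
    exact Hom.mapMem_unique f (hy.precomp a) (Hom.mapMem_left f hab (hy.precomp b))
  -- The given value `z` is compared with the chosen value `y` over the pullback of `x` and `e`.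
  refine ⟨g, fun {U} x z hxz => ?_⟩
  have hs := pullback.condition (f := x) (g := e)
  rw [← cancel_epi (pullback.fst x e), reassoc_of% hs, ← Category.assoc e, hg]
  simp only [← Category.assoc]
  rw [← hq]
  exact Hom.mapMem_unique f (hy.precomp (pullback.snd x e)) (hs ▸ hxz.precomp (pullback.fst x e))

lemma exists_functor_isPresentation : ∃ (G : ExReg C ⥤ D) (q : _), IsPresentation F G q := by
  have := hF.preservesFiniteLimits
  choose m hm using fun (A B : ExReg C) (f : A ⟶ B) => exists_of_mapMem hF Q q hq f
  let G : ExReg C ⥤ D :=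
    { obj := Q
      map {A B} f := m A B f
      map_id A := eq_of_mapMem hF Q q (𝟙 A) (hm _ _ _) (fun x y h => by
        rw [Category.comp_id]
        exact (hq A x y).1 h)
      map_comp {A B E} f g := eq_of_mapMem hF Q q (f ≫ g) (hm _ _ _) (fun x z h => by
        obtain ⟨T', e, he, y, h₁, h₂⟩ := (mapMem_comp hF).1 h
        have k₁ := hm _ _ f _ _ h₁
        have k₂ := hm _ _ g _ _ h₂
        simp only [Category.assoc] at k₁ k₂
        rw [← cancel_epi e, reassoc_of% k₁, k₂]) }
  refine ⟨G, q, inferInstance, fun {A B} f T x y => ⟨hm A B f x y, fun h => ?_⟩⟩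
  -- Conversely, a local value `y'` of `f` at `x` has the same class as `y`; as `q B` has kernel
  -- pair `F B.rel`, the two are related and `y` is a value too.
  obtain ⟨T', e, he, y', h'⟩ := Hom.exists_mapMem f hF x
  have hy : (e ≫ x) ≫ q A ≫ m A B f = y' ≫ q B := hm A B f _ _ h'
  refine .of_cover e (Hom.mapMem_right f h' ((hq B _ _).2 ?_))
  rw [← hy, Category.assoc, Category.assoc]
  exact congrArg (e ≫ ·) h

end Quotients

/-- The image of an equivalence relation under a functor preserving finite limits. -/
lemma isEquivalenceRelation_map {F : C ⥤ D} [PreservesFiniteLimits F] [HasPullbacks D]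
    (A : ExReg C) : IsEquivalenceRelation (F.map (A.rel.arrow ≫ prod.fst))
      (F.map (A.rel.arrow ≫ prod.snd)) := by
  obtain ⟨r, hr₁, hr₂⟩ := A.isEquiv.mapMem_refl (𝟙 (F.obj A.carrier))
  obtain ⟨s, hs₁, hs₂⟩ := A.isEquiv.mapMem_symm (F := F) ⟨𝟙 _, rfl, rfl⟩
  obtain ⟨t, ht₁, ht₂⟩ := A.isEquiv.mapMem_trans (F := F)
    ⟨pullback.fst (F.map (A.rel.arrow ≫ prod.snd)) (F.map (A.rel.arrow ≫ prod.fst)), rfl, rfl⟩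
    ⟨pullback.snd (F.map (A.rel.arrow ≫ prod.snd)) (F.map (A.rel.arrow ≫ prod.fst)),
      pullback.condition.symm, rfl⟩
  exact ⟨⟨{
    right_cancellation := fun _ _ _ h₁ h₂ => map_rel_hom_ext h₁ h₂
    r := r
    reflexivity₁ := hr₁
    reflexivity₂ := hr₂
    s := s
    symmetry₁ := by rw [hs₁, Category.id_comp]
    symmetry₂ := by rw [hs₂, Category.id_comp]
    c := _
    isLimit := pullback.isLimit _ _
    t := t
    transitivity₁ := ht₁
    transitivity₂ := ht₂ }⟩⟩

lemma exists_functor_isPresentation_of_barrExact [BarrExact D] {F : C ⥤ D}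
    (hF : IsRegularFunctor F) : ∃ (G : ExReg C ⥤ D) (q : _), IsPresentation F G q := by
  have := hF.preservesFiniteLimits
  -- Exactness of `D` enters here: the image of `A.rel` is the kernel pair of its quotient.
  have (A : ExReg C) := (BarrExact.effective _ _
    (isEquivalenceRelation_map (F := F) A)).nonempty_effectiveEquivalenceRelation
  let e (A : ExReg C) := (this A).some
  refine exists_functor_isPresentation hF (fun A => (e A).B) (fun A => (e A).π)
    fun A T x x' => ⟨?_, fun h => ?_⟩
  · rintro ⟨t, rfl, rfl⟩
    rw [Category.assoc, (e A).isKernelPair.w, Category.assoc]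
  · exact ⟨(e A).isKernelPair.lift x x' h, IsKernelPair.lift_fst _ _ _ _,
      IsKernelPair.lift_snd _ _ _ _⟩

end ExReg

/-! ### Regularity of a functor with a presentation -/

namespace ExReg.IsPresentation

variable {C : Type u₁} [Category.{v₁} C] [Regular C] {D : Type u₂} [Category.{v₂} D] [Regular D]
  {F : C ⥤ D} {G : ExReg C ⥤ D} {q : ∀ A : ExReg C, F.obj A.carrier ⟶ G.obj A}
  (h : IsPresentation F G q)
include h

omit [Regular D] in
lemma mapMem_rel_iff {A : ExReg C} {T : D} (x x' : T ⟶ F.obj A.carrier) :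
    MapMem F A.rel x x' ↔ x ≫ q A = x' ≫ q A := by
  have := h.mapMem_iff (𝟙 A) x x'
  rwa [G.map_id, Category.comp_id] at this

lemma exists_lift {A : ExReg C} {T : D} (w : T ⟶ G.obj A) :
    ∃ (T' : D) (e : T' ⟶ T) (_ : IsRegularEpi e) (x : T' ⟶ F.obj A.carrier), x ≫ q A = e ≫ w :=
  have := h.isRegularEpi A
  ⟨_, pullback.fst w (q A), inferInstance, pullback.snd w (q A), pullback.condition.symm⟩

omit [Regular D] in
lemma map_ofMap {A B : ExReg C} (f : A.carrier ⟶ B.carrier)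
    (hf : ∀ {T : C} {x x' : T ⟶ A.carrier}, Mem A.rel x x' → Mem B.rel (x ≫ f) (x' ≫ f)) :
    q A ≫ G.map (ofMap A B f hf) = F.map f ≫ q B := by
  have : MapMem F (ofMap A B f hf).rel (𝟙 _) (F.map f) := by
    simpa using MapMem.of_mem F (mem_ofMap (hf := hf) (x := 𝟙 _).2 (B.isEquiv.mem_refl _)) (𝟙 _)
  simpa using (h.mapMem_iff _ _ _).1 this

omit [Regular D] in
-- The kernel pair of this regular epimorphism is the image of the equality relation, so it is also
-- mono.
lemma isIso_discrete (X : C) : IsIso (q (discrete X)) := by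
  have := h.isRegularEpi (discrete X)
  have : Mono (q (discrete X)) := ⟨fun a b hab => by
    rw [← h.mapMem_rel_iff] at hab
    simpa using mapMem_graph.1 hab⟩
  exact isIso_of_mono_of_strongEpi _

omit [Regular D] in
lemma nonempty_unit_comp_iso : Nonempty (ExReg.unit C ⋙ G ≅ F) :=
  ⟨(NatIso.ofComponents (fun X => @asIso _ _ _ _ (q (discrete X)) (h.isIso_discrete X)) (fun {X Y} f => by
    have := h.map_ofMap (A := discrete X) (B := discrete Y) f
      (fun h => mem_of_mem_discrete h (discrete Y) f)
    rw [← graphHom_eq_ofMap] at this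
    exact this.symm)).symm⟩

/-- A local preimage `x` of the generic element of `B` exhibits the cover `F.map e ≫ q B` as a
composite ending in `G.map f`. -/
lemma map_isRegularEpi (hF : IsRegularFunctor F) {A B : ExReg C} (f : A ⟶ B) [IsRegularEpi f] :
    IsRegularEpi (G.map f) := by
  obtain ⟨T, e, he, x, hx⟩ := exists_mem_of_isRegularEpi f (𝟙 B.carrier)
  rw [Category.comp_id] at hx
  have := hF.map_isRegularEpi e he
  have := h.isRegularEpi B
  have := isRegularEpi_comp (F.map e) (q B)
  have hx' := (h.mapMem_iff f _ _).1 (.of_mem F hx (𝟙 _))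
  rw [Category.id_comp, Category.id_comp, ← Category.assoc] at hx'
  have : StrongEpi ((F.map x ≫ q A) ≫ G.map f) := by
    rw [hx']
    infer_instance
  have : StrongEpi (G.map f) := strongEpi_of_strongEpi (F.map x ≫ q A) _
  exact isRegularEpi_of_strongEpi _

lemma mapMem_pullbackRel (hF : IsRegularFunctor F) {A B E : ExReg C} {f : A ⟶ E} {g : B ⟶ E}
    {T : D} {t t' : T ⟶ F.obj (pullbackObj f g).carrier} :
    MapMem F (pullbackObj f g).rel t t' ↔
      (t ≫ F.map (pullbackFst f g)) ≫ q A = (t' ≫ F.map (pullbackFst f g)) ≫ q A ∧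
      (t ≫ F.map (pullbackSnd f g)) ≫ q B = (t' ≫ F.map (pullbackSnd f g)) ≫ q B := by
  have := hF.preservesFiniteLimits
  change MapMem F (pullbackRel f g) t t' ↔ _
  rw [pullbackRel, mapMem_inf, mapMem_inverseImage hF, mapMem_inverseImage hF,
    h.mapMem_rel_iff, h.mapMem_rel_iff]

lemma isPullback_map (hF : IsRegularFunctor F) {A B E : ExReg C} (f : A ⟶ E) (g : B ⟶ E) :
    IsPullback
      (G.map (ofMap (pullbackObj f g) A (pullbackFst f g) fun h => (mem_pullbackRel.1 h).1))
      (G.map (ofMap (pullbackObj f g) B (pullbackSnd f g) fun h => (mem_pullbackRel.1 h).2))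
      (G.map f) (G.map g) := by
  have := hF.preservesFiniteLimits
  have k₁ := h.map_ofMap (A := pullbackObj f g) (B := A) (pullbackFst f g)
    fun h => (mem_pullbackRel.1 h).1
  have k₂ := h.map_ofMap (A := pullbackObj f g) (B := B) (pullbackSnd f g)
    fun h => (mem_pullbackRel.1 h).2
  -- Uniqueness is proved separately because it also supplies the compatibility needed to descend
  -- the lift.
  have ext {W : D} (l l' : W ⟶ G.obj (pullbackObj f g))
      (h₁ : l ≫ G.map (ofMap (pullbackObj f g) A (pullbackFst f g)
        fun h => (mem_pullbackRel.1 h).1) = l' ≫ G.map (ofMap (pullbackObj f g) A (pullbackFst f g)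
        fun h => (mem_pullbackRel.1 h).1))
      (h₂ : l ≫ G.map (ofMap (pullbackObj f g) B (pullbackSnd f g)
        fun h => (mem_pullbackRel.1 h).2) = l' ≫ G.map (ofMap (pullbackObj f g) B (pullbackSnd f g)
        fun h => (mem_pullbackRel.1 h).2)) : l = l' := by
    obtain ⟨T, e, _, t, ht⟩ := h.exists_lift l
    obtain ⟨T', e', _, t', ht'⟩ := h.exists_lift (e ≫ l')
    rw [← cancel_epi e, ← cancel_epi e', ← ht, ← ht', ← Category.assoc, ← h.mapMem_rel_iff,
      h.mapMem_pullbackRel hF]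
    simp only [Category.assoc, ← k₁, ← k₂]
    rw [reassoc_of% ht, reassoc_of% ht', reassoc_of% ht, reassoc_of% ht', h₁, h₂]
    exact ⟨rfl, rfl⟩
  refine IsPullback.of_exists ?_ (fun {W} a b hab => ?_) ext
  · rw [← G.map_comp, ← G.map_comp, (isPullback_pullbackObj f g).w]
  · obtain ⟨T₁, e₁, _, x, hx⟩ := h.exists_lift a
    obtain ⟨T₂, e₂, _, y, hy⟩ := h.exists_lift (e₁ ≫ b)
    obtain ⟨T₃, e₃, _, z, hz⟩ := h.exists_lift (e₂ ≫ x ≫ q A ≫ G.map f)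
    have hfz : MapMem F f.rel (e₃ ≫ e₂ ≫ x) z := by
      rw [h.mapMem_iff, hz]
      simp only [Category.assoc]
    have hgz : MapMem F g.rel (e₃ ≫ y) z := by
      rw [h.mapMem_iff, hz, Category.assoc, reassoc_of% hy, reassoc_of% hx, hab]
    obtain ⟨t, ht₁, ht₂⟩ := mapMem_comp_of_mapMem hfz (mapMem_opp.2 hgz)
    have := isRegularEpi_comp e₂ e₁
    have := isRegularEpi_comp e₃ (e₂ ≫ e₁)
    have l₁ : t ≫ q (pullbackObj f g) ≫ G.map (ofMap (pullbackObj f g) A (pullbackFst f g)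
        fun h => (mem_pullbackRel.1 h).1) = (e₃ ≫ e₂ ≫ e₁) ≫ a := by
      rw [k₁, reassoc_of% ht₁, hx]
      simp only [Category.assoc]
    have l₂ : t ≫ q (pullbackObj f g) ≫ G.map (ofMap (pullbackObj f g) B (pullbackSnd f g)
        fun h => (mem_pullbackRel.1 h).2) = (e₃ ≫ e₂ ≫ e₁) ≫ b := by
      rw [k₂, reassoc_of% ht₂, hy]
      simp only [Category.assoc]
    obtain ⟨l, hl⟩ := exists_desc (e₃ ≫ e₂ ≫ e₁) (t ≫ q (pullbackObj f g)) fun u v huv => by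
      apply ext
      · simp only [Category.assoc, l₁]
        simpa using huv =≫ a
      · simp only [Category.assoc, l₂]
        simpa using huv =≫ b
    refine ⟨l, ?_, ?_⟩
    · rw [← cancel_epi (e₃ ≫ e₂ ≫ e₁), ← Category.assoc (e₃ ≫ e₂ ≫ e₁), hl, Category.assoc, l₁]
    · rw [← cancel_epi (e₃ ≫ e₂ ≫ e₁), ← Category.assoc (e₃ ≫ e₂ ≫ e₁), hl, Category.assoc, l₂]

lemma isRegularFunctor (hF : IsRegularFunctor F) : IsRegularFunctor G where
  preservesFiniteLimits := by
    have := hF.preservesFiniteLimits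
    have := h.isIso_discrete
    have : PreservesLimit (Functor.empty.{0} (ExReg C)) G :=
      preservesTerminal_of_iso G
        (G.mapIso (terminalIsTerminal.uniqueUpToIso isTerminalDiscrete) ≪≫
          (asIso (q (discrete (⊤_ C)))).symm ≪≫ PreservesTerminal.iso F)
    have := preservesLimitsOfShape_pempty_of_preservesTerminal G
    have (A B E : ExReg C) (f : A ⟶ E) (g : B ⟶ E) : PreservesLimit (cospan f g) G :=
      preservesLimit_of_preserves_limit_cone (isPullback_pullbackObj f g).isLimit
        ((isLimitMapConePullbackConeEquiv G (isPullback_pullbackObj f g).w).symm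
          (h.isPullback_map hF f g).isLimit)
    have : PreservesLimitsOfShape WalkingCospan G :=
      ⟨fun {K} => preservesLimit_of_iso_diagram G (diagramIsoCospan K).symm⟩
    exact preservesFiniteLimits_of_preservesTerminal_and_pullbacks G
  map_isRegularEpi f _ := h.map_isRegularEpi hF f

/-! ### The three conditions make the induced functor an equivalence -/

section Equivalence

variable [PreservesFiniteLimits F] [F.Full] [F.Faithful]

omit [Regular D] [PreservesFiniteLimits F] h in
-- The hypothesis at the generic pair of `F R` factors it through `F S`; fullness lifts the
-- factorization to `C` and faithfulness lifts its equations.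
lemma _root_.InternalRel.le_of_mapMem {X Y : C} {R S : Relation X Y}
    (hRS : ∀ {T : D} (x : T ⟶ F.obj X) (y : T ⟶ F.obj Y), MapMem F R x y → MapMem F S x y) :
    R ≤ S := by
  obtain ⟨t, h₁, h₂⟩ := hRS _ _ ⟨𝟙 (F.obj (R : C)), rfl, rfl⟩
  rw [Category.id_comp] at h₁ h₂
  rw [le_iff_mem_arrow, mem_iff]
  refine ⟨F.preimage t, F.map_injective ?_, F.map_injective ?_⟩
  · rw [F.map_comp, F.map_preimage, h₁]
  · rw [F.map_comp, F.map_preimage, h₂]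

omit [Regular D] h in
-- The pullback of `f` and `g` is a subobject of `F (X ⨯ Y)`, so closure under subobjects makes it
-- some `F Z`. Fullness turns the inclusion into `F z`, and faithfulness makes `z` mono.
lemma _root_.InternalRel.exists_mapMem_iff [HasPullbacks D]
    (hF : F.essImage.IsClosedUnderSubobjects) {X Y : C} {d : D} (f : F.obj X ⟶ d) (g : F.obj Y ⟶ d) : ∃ R : Relation X Y,
      ∀ {T : D} (x : T ⟶ F.obj X) (y : T ⟶ F.obj Y), MapMem F R x y ↔ x ≫ f = y ≫ g := by
  obtain ⟨m, hm₁, hm₂⟩ := exists_map_prod_lift (F := F) (pullback.fst f g) (pullback.snd f g)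
  have : Mono m := ⟨fun a b hab => by
    apply pullback.hom_ext
    · rw [← hm₁, reassoc_of% hab]
    · rw [← hm₂, reassoc_of% hab]⟩
  obtain ⟨Z, ⟨e⟩⟩ := F.essImage.prop_of_mono m (F.obj_mem_essImage _)
  obtain ⟨z, hz⟩ := F.map_surjective (e.hom ≫ m)
  have : Mono (F.map z) := by
    rw [hz]
    infer_instance
  have : Mono z := F.mono_of_mono_map this
  have mem_z : Mem (Subobject.mk z) (z ≫ prod.fst) (z ≫ prod.snd) :=
    mem_iff.2 ⟨(Subobject.underlyingIso z).inv, by simp, by simp⟩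
  refine ⟨Subobject.mk z, fun {T} x y => ⟨?_, fun h => ?_⟩⟩
  · rintro ⟨t, rfl, rfl⟩
    rw [← Subobject.underlyingIso_hom_comp_eq_mk]
    simp only [F.map_comp, hz, Category.assoc, reassoc_of% hm₁, reassoc_of% hm₂,
      pullback.condition]
  · have := MapMem.of_mem F mem_z (pullback.lift x y h ≫ e.inv)
    simpa [hz, hm₁, hm₂, pullback.lift_fst, pullback.lift_snd] using this

omit [Regular D] [PreservesFiniteLimits F] in
lemma faithful : G.Faithful where
  map_injective {A B f g} hfg := Hom.ext (le_antisymm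
    (le_of_mapMem (F := F) fun x y hxy => by
      rw [h.mapMem_iff] at hxy ⊢
      rwa [← hfg])
    (le_of_mapMem (F := F) fun x y hxy => by
      rw [h.mapMem_iff] at hxy ⊢
      rwa [hfg]))

/-- The relation of the preimage is the pullback of `q A ≫ g` and `q B`. Each law can be tested
after applying `F`, where it becomes an equation between morphisms of `D`. -/
lemma full (hF : IsRegularFunctor F) (hsub : F.essImage.IsClosedUnderSubobjects) : G.Full where
  map_surjective {A B} g := by
    obtain ⟨M, hM⟩ := exists_mapMem_iff hsub (q A ≫ g) (q B)
    let f : A ⟶ B :=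
      { rel := M
        left_comp := by
          apply le_antisymm <;> refine le_of_mapMem (F := F) fun {T} x y hxy => ?_
          · obtain ⟨T', e, he, x', h₁, h₂⟩ := (mapMem_comp hF).1 hxy
            refine .of_cover e ?_
            rw [h.mapMem_rel_iff] at h₁
            rw [hM] at h₂ ⊢
            rw [← Category.assoc (e ≫ x), h₁, Category.assoc, h₂]
          · exact mapMem_comp_of_mapMem (A.isEquiv.mapMem_refl x) hxy
        comp_right := by
          apply le_antisymm <;> refine le_of_mapMem (F := F) fun {T} x y hxy => ?_
          · obtain ⟨T', e, he, x', h₁, h₂⟩ := (mapMem_comp hF).1 hxy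
            refine .of_cover e ?_
            rw [h.mapMem_rel_iff] at h₂
            rw [hM] at h₁ ⊢
            rw [h₁, h₂]
          · exact mapMem_comp_of_mapMem hxy (B.isEquiv.mapMem_refl y)
        total := le_of_mapMem (F := F) fun x x' hx => by
          obtain ⟨T', e, he, y, hy⟩ := h.exists_lift (x ≫ q A ≫ g)
          rw [h.mapMem_rel_iff] at hx
          refine .of_cover e (mapMem_comp_of_mapMem (y := y) ?_ (mapMem_opp.2 ?_))
          · rw [hM, hy, Category.assoc]
          · rw [hM, hy, Category.assoc, reassoc_of% hx]
        singleValued := le_of_mapMem (F := F) fun y y' hy => by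
          obtain ⟨T', e, he, x, h₁, h₂⟩ := (mapMem_comp hF).1 hy
          rw [mapMem_opp, hM] at h₁
          rw [hM] at h₂
          refine .of_cover e ?_
          rw [h.mapMem_rel_iff, ← h₁, ← h₂] }
    refine ⟨f, ?_⟩
    have := h.isRegularEpi A
    obtain ⟨T, e, he, y, hy⟩ := h.exists_lift (q A ≫ g)
    rw [← cancel_epi (q A), ← cancel_epi e, ← hy, ← h.mapMem_iff]
    exact (hM _ _).2 hy.symm

/-- The kernel pair of a cover `p` of `d` comes from an equivalence relation on `X`. Then `p` and `q
A` are regular epimorphisms with the same kernel pair, so their targets are isomorphic. -/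
lemma essSurj (hF : IsRegularFunctor F) (hsub : F.essImage.IsClosedUnderSubobjects)
    (hcov : ∀ d : D, ∃ (x : C) (p : F.obj x ⟶ d), IsRegularEpi p) : G.EssSurj where
  mem_essImage d := by
    obtain ⟨X, p, hp⟩ := hcov d
    obtain ⟨R, hR⟩ := exists_mapMem_iff hsub p p
    let A : ExReg C := ⟨X, R,
      { refl := le_of_mapMem (F := F) fun x y hxy => by
          rw [mapMem_graph, F.map_id, Category.comp_id] at hxy
          rw [hR, hxy]
        symm := le_of_mapMem (F := F) fun x y hxy => by
          rw [mapMem_opp, hR]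
          exact ((hR _ _).1 hxy).symm
        trans := le_of_mapMem (F := F) fun x y hxy => by
          obtain ⟨T', e, he, z, h₁, h₂⟩ := (mapMem_comp hF).1 hxy
          rw [hR] at h₁ h₂
          refine .of_cover e ?_
          rw [hR, h₁, h₂] }⟩
    have := h.isRegularEpi A
    have hA {T : D} (x y : T ⟶ F.obj X) : x ≫ q A = y ≫ q A ↔ x ≫ p = y ≫ p :=
      (h.mapMem_rel_iff (A := A) x y).symm.trans (hR x y)
    obtain ⟨a, ha⟩ := exists_desc (q A) p fun x y => (hA x y).1
    obtain ⟨b, hb⟩ := exists_desc p (q A) fun x y => (hA x y).2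
    refine ⟨A, ⟨a, b, ?_, ?_⟩⟩
    · rw [← cancel_epi (q A), reassoc_of% ha, hb, Category.comp_id]
    · rw [← cancel_epi p, reassoc_of% hb, ha, Category.comp_id]

end Equivalence

end ExReg.IsPresentation

theorem mainTheorem9 {X : Type u₁} [Category.{v₁} X] [Regular X]
    {D : Type u₂} [Category.{v₂} D] [BarrExact D] (F : X ⥤ D) (hF : IsRegularFunctor F) :
    (∃ G : ExReg X ⥤ D, IsRegularFunctor G ∧ Nonempty (ExReg.unit X ⋙ G ≅ F)) ∧
    ∀ G : ExReg X ⥤ D, IsRegularFunctor G → Nonempty (ExReg.unit X ⋙ G ≅ F) →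
      (G.IsEquivalence ↔
        (F.Full ∧ F.Faithful) ∧
        F.essImage.IsClosedUnderSubobjects ∧
        ∀ d : D, ∃ (x : X) (q : F.obj x ⟶ d), IsRegularEpi q) := by
  refine ⟨?_, fun G hG ⟨α⟩ => ⟨fun hE => ⟨⟨?_, ?_⟩, ⟨fun {d e} m _ ⟨y, ⟨i⟩⟩ => ?_⟩, fun d => ?_⟩, ?_⟩⟩
  · obtain ⟨G, q, h⟩ := ExReg.exists_functor_isPresentation_of_barrExact hF
    exact ⟨G, h.isRegularFunctor hF, h.nonempty_unit_comp_iso⟩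
  · exact Functor.Full.of_iso α
  · exact Functor.Faithful.of_iso α
  -- The subobject is transported back along `G` to a subobject of a discrete object, which is again
  -- discrete up to isomorphism.
  · let j : G.obj (G.objPreimage d) ≅ d := G.objObjPreimageIso d
    let a : F.obj y ≅ G.obj (ExReg.discrete y) := (α.app y).symm
    let n : G.objPreimage d ⟶ ExReg.discrete y := G.preimage (j.hom ≫ m ≫ i.inv ≫ a.hom)
    have : Mono (G.map n) := by
      rw [G.map_preimage]
      infer_instance
    have : Mono n := G.mono_of_mono_map this
    obtain ⟨x, ⟨k⟩⟩ := ExReg.exists_iso_discrete_of_mono n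
    exact ⟨x, ⟨(α.app x).symm ≪≫ G.mapIso k ≪≫ j⟩⟩
  · let j : G.obj (G.objPreimage d) ≅ d := G.objObjPreimageIso d
    obtain ⟨q, h⟩ := ExReg.exists_isPresentation hG α
    have := h.isRegularEpi (G.objPreimage d)
    exact ⟨_, q _ ≫ j.hom, isRegularEpi_comp _ _⟩
  · rintro ⟨⟨_, _⟩, hsub, hcov⟩
    obtain ⟨q, h⟩ := ExReg.exists_isPresentation hG α
    have := hF.preservesFiniteLimits
    exact { faithful := h.faithful, full := h.full hF hsub, essSurj := h.essSurj hF hsub hcov }
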